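/- \textbf{Theorem (Random matrix inner product CLT).} For all $m,n\in\mathbb N$ let $X=(x_1,\dots,x_n)^T$ and $Z=(z_1,\dots,z_n)^T$ be random vectors in $\mathbb R^n$ and let $S=(S_{i,j})$ be a random $m\times n$ real matrix, all defined on one probability space (the space and the laws may depend on $(m,n)$). Assume that the entries of $X$ are identically distributed, likewise those of $Z$ and those of $S$, and that all entries of $X$, $Z$ and $S$ together are mutually independent. Assume $$E x_i=E z_i=E S_{i,j}=0,\qquad E x_i^2=E z_i^2=E S_{i,j}^2=1,$$ and that there is a constant $C<\infty$, independent of $m$ and $n$, with $$E|x_i|^3<C,\qquad E|z_i|^3<C,\qquad E z_i^4<C,\qquad E S_{i,j}^8<C .$$ Then $$\frac{1}{\sqrt{m^2n+mn^2}}\,X^TS^TSZ\;\longrightarrow\;\mathcal N(0,1)\quad\text{in distribution, as } m,n\to\infty,$$ i.e. as $m$ and $n$ tend to infinity jointly, with no condition on their relative rates. -/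

import Mathlib

open MeasureTheory ProbabilityTheory Filter Matrix

/-!
Write `U = S X` and `V = S Z`, so that `Xᵀ Sᵀ S Z = ∑ a, U a * V a`. Conditionally on `X` and
`Z`, the rows of `S` being independent, this is a sum of `m` independent variables with mean `⟨X,
Z⟩`. By polarization of the second and fourth moments of a linear form, each of them has variance
`‖X‖² ‖Z‖² + ⟨X, Z⟩² + ∑ i, (E S_{a i}⁴ - 3) X i ^ 2 Z i ^ 2`. By the weak law of large numbers
`iIndepFun.integral_abs_sum_sq_sub_card_le`, both `‖X‖²` and `‖Z‖²` are `n + o(n)` in `L¹`, while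
the two other terms have expectation of order `n`; hence the conditional variance of the sum is
close to `m n²`. A bound on sixth moments of linear forms controls the third absolute moments,
and `norm_integral_cexp_bilinear_sub_le` shows that, conditionally, the sum is close to a
Gaussian of mean `m ⟨X, Z⟩` and variance `m n²`.

The centre `m ⟨X, Z⟩ = m ∑ i, X i * Z i` is in turn a sum of `n` independent centred variables,
close to a Gaussian of variance `m² n`. The two fluctuations are asymptotically independent and
their variances add up to the normalization `m² n + m n²`. Since each of them is at most the
total, no assumption on the relative size of `m` and `n` is needed:
`norm_integral_cexp_bilinear_sub_exp_le` gives an explicit bound on the distance of the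
characteristic functions which tends to zero as soon as `m` and `n` both tend to infinity, and
Lévy's continuity theorem concludes.
-/

/-! ### Characteristic functions of sums of independent variables -/

/-- Second-order Taylor estimate valid for all real `x`, with a constant that is not optimal: for
`|x| ≤ 1` it comes from the exponential series, for `|x| ≥ 1` from the triangle inequality. -/
theorem norm_cexp_mul_I_sub_quadratic_le (x : ℝ) :
    ‖Complex.exp (x * Complex.I) - (1 + x * Complex.I - (x : ℂ) ^ 2 / 2)‖ ≤ 4 * |x| ^ 3 := by
  have hn : ‖(x : ℂ) * Complex.I‖ = |x| := by simp
  have hx0 := abs_nonneg x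
  rcases le_total |x| 1 with h | h
  · have h1 := Complex.norm_exp_sub_sum_le_norm_mul_exp ((x : ℂ) * Complex.I) 3
    have h2 : ∑ m ∈ Finset.range 3, ((x : ℂ) * Complex.I) ^ m / m.factorial
        = 1 + x * Complex.I - (x : ℂ) ^ 2 / 2 := by
      simp [Finset.sum_range_succ, Nat.factorial, mul_pow, Complex.I_sq]
      ring
    rw [h2, hn] at h1
    have h3 : Real.exp |x| ≤ 4 := by
      have := Real.exp_one_lt_d9
      have h4 : Real.exp |x| ≤ Real.exp 1 := Real.exp_le_exp.2 h
      linarith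
    calc _ ≤ |x| ^ 3 * Real.exp |x| := h1
      _ ≤ |x| ^ 3 * 4 := by gcongr
      _ = _ := by ring
  · have h1 : ‖Complex.exp (x * Complex.I)‖ = 1 := Complex.norm_exp_ofReal_mul_I x
    have h2 : ‖(1 : ℂ) + x * Complex.I - (x : ℂ) ^ 2 / 2‖ ≤ 1 + |x| + |x| ^ 2 / 2 := by
      refine (norm_sub_le _ _).trans (add_le_add ((norm_add_le _ _).trans ?_) ?_)
      · simp
      · simp
    have h3 : |x| ≤ |x| ^ 3 := le_self_pow₀ h (by norm_num)
    have h4 : |x| ^ 2 ≤ |x| ^ 3 := pow_le_pow_right₀ h (by norm_num)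
    have h5 := norm_sub_le (Complex.exp (x * Complex.I)) (1 + x * Complex.I - (x : ℂ) ^ 2 / 2)
    linarith

theorem abs_exp_neg_sq_div_two_sub_le {c : ℝ} (hc : 0 ≤ c) :
    |Real.exp (-(c ^ 2 / 2)) - (1 - c ^ 2 / 2)| ≤ c ^ 3 := by
  have h0 : 1 - c ^ 2 / 2 ≤ Real.exp (-(c ^ 2 / 2)) := by
    have := Real.add_one_le_exp (-(c ^ 2 / 2)); linarith
  have h1 : Real.exp (-(c ^ 2 / 2)) ≤ 1 := Real.exp_le_one_iff.2 (by nlinarith [sq_nonneg c])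
  rw [abs_of_nonneg (by linarith)]
  rcases le_total c 1 with h | h
  · have h2 := Real.abs_exp_sub_one_sub_id_le (x := -(c ^ 2 / 2))
      (by rw [abs_neg, abs_of_nonneg (by positivity)]; nlinarith)
    have h3 := (abs_le.1 h2).2
    nlinarith [pow_nonneg hc 3, mul_nonneg (pow_nonneg hc 3) (sub_nonneg.2 h)]
  · have h4 : c ^ 2 ≤ c ^ 3 := pow_le_pow_right₀ h (by norm_num)
    nlinarith

theorem abs_exp_neg_sub_exp_neg_le {a b : ℝ} (ha : 0 ≤ a) (hb : 0 ≤ b) :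
    |Real.exp (-a) - Real.exp (-b)| ≤ |a - b| := by
  wlog h : a ≤ b generalizing a b
  · rw [abs_sub_comm, abs_sub_comm a]; exact this hb ha (le_of_not_ge h)
  have h1 : Real.exp (-b) ≤ Real.exp (-a) := Real.exp_le_exp.2 (by linarith)
  rw [abs_of_nonneg (by linarith), abs_of_nonpos (by linarith)]
  have h2 : Real.exp (-b) = Real.exp (-a) * Real.exp (a - b) := by rw [← Real.exp_add]; ring_nf
  have h3 := Real.add_one_le_exp (a - b)
  have h4 : Real.exp (-a) ≤ 1 := Real.exp_le_one_iff.2 (by linarith)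
  have h5 := Real.exp_pos (-a)
  nlinarith

/-- Telescoping estimate for products of complex numbers in the closed unit disc; it turns
one-factor characteristic function errors into an error for a sum of independent variables. -/
theorem norm_prod_sub_prod_le_sum {ι : Type*} (s : Finset ι) (f g : ι → ℂ)
    (hf : ∀ i ∈ s, ‖f i‖ ≤ 1) (hg : ∀ i ∈ s, ‖g i‖ ≤ 1) :
    ‖∏ i ∈ s, f i - ∏ i ∈ s, g i‖ ≤ ∑ i ∈ s, ‖f i - g i‖ := by
  classical
  induction s using Finset.induction_on with
  | empty => simp
  | insert a s ha ih =>
    rw [Finset.prod_insert ha, Finset.prod_insert ha, Finset.sum_insert ha]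
    have h1 : f a * ∏ i ∈ s, f i - g a * ∏ i ∈ s, g i
        = (f a - g a) * ∏ i ∈ s, f i + g a * (∏ i ∈ s, f i - ∏ i ∈ s, g i) := by ring
    have h2 : ‖∏ i ∈ s, f i‖ ≤ 1 := by
      rw [norm_prod]
      exact Finset.prod_le_one (fun _ _ => norm_nonneg _)
        fun i hi => hf i (Finset.mem_insert_of_mem hi)
    rw [h1]
    refine (norm_add_le _ _).trans (add_le_add ?_ ?_)
    · rw [norm_mul]
      exact mul_le_of_le_one_right (norm_nonneg _) h2
    · rw [norm_mul]
      exact (mul_le_of_le_one_left (norm_nonneg _) (hg a (Finset.mem_insert_self a s))).trans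
        (ih (fun i hi => hf i (Finset.mem_insert_of_mem hi))
          fun i hi => hg i (Finset.mem_insert_of_mem hi))

section CharFun
variable {Ω : Type*} [MeasurableSpace Ω] {P : Measure Ω} [IsProbabilityMeasure P]

theorem integrable_abs_pow_of_le {f : Ω → ℝ} (hf : AEMeasurable f P) {j k : ℕ} (hjk : j ≤ k)
    (h : Integrable (fun ω => |f ω| ^ k) P) : Integrable (fun ω => |f ω| ^ j) P :=
  integrable_norm_pow_of_le hf.aestronglyMeasurable hjk h

theorem integrable_pow_of_abs_pow {f : Ω → ℝ} (hf : AEMeasurable f P) {j k : ℕ} (hjk : j ≤ k)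
    (h : Integrable (fun ω => |f ω| ^ k) P) : Integrable (fun ω => f ω ^ j) P :=
  (integrable_abs_pow_of_le hf hjk h).mono' (hf.pow_const j).aestronglyMeasurable
    (Eventually.of_forall fun ω => by simp)

/-- Lyapunov's inequality between the second and third absolute moments, obtained by integrating
`3 √v y² ≤ 2 y³ + √v³`. -/
theorem sqrt_integral_sq_pow_three_le {f : Ω → ℝ} (hf : AEMeasurable f P)
    (h3 : Integrable (fun ω => |f ω| ^ 3) P) :
    √(∫ ω, f ω ^ 2 ∂P) ^ 3 ≤ ∫ ω, |f ω| ^ 3 ∂P := by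
  set v := ∫ ω, f ω ^ 2 ∂P with hv
  have hv0 : 0 ≤ v := integral_nonneg fun ω => sq_nonneg _
  have h2 := integrable_pow_of_abs_pow hf (show 2 ≤ 3 by norm_num) h3
  have key : ∫ ω, (3 * √v) * f ω ^ 2 ∂P ≤ ∫ ω, (2 * |f ω| ^ 3 + √v ^ 3) ∂P := by
    refine integral_mono (h2.const_mul _) ((h3.const_mul _).add (integrable_const _)) fun ω => ?_
    have h0 := abs_nonneg (f ω)
    have hs := Real.sqrt_nonneg v
    simp only
    rw [← sq_abs (f ω)]
    nlinarith [mul_nonneg (add_nonneg (mul_nonneg zero_le_two h0) hs) (sq_nonneg (|f ω| - √v))]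
  rw [integral_const_mul, integral_add (h3.const_mul _) (integrable_const _), integral_const_mul,
    ← hv] at key
  simp only [integral_const, probReal_univ, smul_eq_mul, one_mul] at key
  have h4 : √v ^ 3 = √v * v := by rw [pow_succ', Real.sq_sqrt hv0]
  nlinarith

theorem integrable_cexp_mul_I {f : Ω → ℝ} (hf : AEMeasurable f P) :
    Integrable (fun ω => Complex.exp (f ω * Complex.I)) P :=
  (integrable_const (1 : ℝ)).mono' (by fun_prop)
    (Eventually.of_forall fun ω => (Complex.norm_exp_ofReal_mul_I _).le)

theorem norm_integral_cexp_mul_I_le (f : Ω → ℝ) :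
    ‖∫ ω, Complex.exp (f ω * Complex.I) ∂P‖ ≤ 1 := by
  refine (norm_integral_le_of_norm_le_const (C := 1) (Eventually.of_forall fun ω => ?_)).trans ?_
  · exact (Complex.norm_exp_ofReal_mul_I _).le
  · simp

/-- The characteristic function of a centred variable is close to that of the Gaussian with the same
variance, with an error controlled by the third absolute moment. No smallness of `u` is needed. -/
theorem norm_integral_cexp_sub_exp_le {f : Ω → ℝ} (hf : AEMeasurable f P)
    (h3 : Integrable (fun ω => |f ω| ^ 3) P) (h0 : ∫ ω, f ω ∂P = 0) (u : ℝ) :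
    ‖∫ ω, Complex.exp ((u * f ω : ℝ) * Complex.I) ∂P
        - (Real.exp (-(u ^ 2 * (∫ ω, f ω ^ 2 ∂P) / 2)) : ℂ)‖
      ≤ 5 * |u| ^ 3 * ∫ ω, |f ω| ^ 3 ∂P := by
  set v := ∫ ω, f ω ^ 2 ∂P with hv
  have hv0 : 0 ≤ v := integral_nonneg fun ω => sq_nonneg _
  have h2 := integrable_pow_of_abs_pow hf (show 2 ≤ 3 by norm_num) h3
  have h1 : Integrable f P := by
    simpa using integrable_pow_of_abs_pow hf (show 1 ≤ 3 by norm_num) h3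
  have hI1 : Integrable (fun ω => Complex.exp ((u * f ω : ℝ) * Complex.I)) P :=
    integrable_cexp_mul_I (hf.const_mul u)
  have hfC : Integrable (fun ω => (f ω : ℂ)) P := h1.ofReal
  have hf2C : Integrable (fun ω => ((f ω ^ 2 : ℝ) : ℂ)) P := h2.ofReal
  have hI2 : Integrable (fun ω => (1 : ℂ) + (u * f ω : ℝ) * Complex.I
      - ((u * f ω : ℝ) : ℂ) ^ 2 / 2) P := by
    have : (fun ω => (1 : ℂ) + (u * f ω : ℝ) * Complex.I - ((u * f ω : ℝ) : ℂ) ^ 2 / 2)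
      = fun ω => (1 : ℂ) + (u * Complex.I) * (f ω : ℂ) - ((u : ℂ) ^ 2 / 2) * ((f ω ^ 2 : ℝ) : ℂ) := by
      ext ω; push_cast; ring
    rw [this]
    exact ((integrable_const _).add (hfC.const_mul _)).sub (hf2C.const_mul _)
  have hval : ∫ ω, ((1 : ℂ) + (u * f ω : ℝ) * Complex.I - ((u * f ω : ℝ) : ℂ) ^ 2 / 2) ∂P
      = ((1 - u ^ 2 * v / 2 : ℝ) : ℂ) := by
    have : (fun ω => (1 : ℂ) + (u * f ω : ℝ) * Complex.I - ((u * f ω : ℝ) : ℂ) ^ 2 / 2)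
      = fun ω => (1 : ℂ) + (u * Complex.I) * (f ω : ℂ) - ((u : ℂ) ^ 2 / 2) * ((f ω ^ 2 : ℝ) : ℂ) := by
      ext ω; push_cast; ring
    have hlin : Integrable (fun ω => (1 : ℂ) + (u * Complex.I) * (f ω : ℂ)) P :=
      (integrable_const _).add (hfC.const_mul _)
    rw [this, integral_sub hlin (hf2C.const_mul _),
      integral_add (integrable_const _) (hfC.const_mul _), integral_const_mul, integral_const_mul,
      integral_complex_ofReal, integral_complex_ofReal, h0, ← hv]
    simp
    ring
  have hA : ‖∫ ω, Complex.exp ((u * f ω : ℝ) * Complex.I) ∂P - ((1 - u ^ 2 * v / 2 : ℝ) : ℂ)‖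
      ≤ 4 * |u| ^ 3 * ∫ ω, |f ω| ^ 3 ∂P := by
    rw [← hval, ← integral_sub hI1 hI2, ← integral_const_mul]
    refine norm_integral_le_of_norm_le (h3.const_mul _) (Eventually.of_forall fun ω => ?_)
    refine (norm_cexp_mul_I_sub_quadratic_le (u * f ω)).trans (le_of_eq ?_)
    rw [abs_mul, mul_pow]; ring
  have hB : ‖((1 - u ^ 2 * v / 2 : ℝ) : ℂ) - (Real.exp (-(u ^ 2 * v / 2)) : ℂ)‖
      ≤ |u| ^ 3 * ∫ ω, |f ω| ^ 3 ∂P := by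
    have h5 := abs_exp_neg_sq_div_two_sub_le (c := |u| * √v) (by positivity)
    rw [mul_pow, sq_abs, Real.sq_sqrt hv0, abs_sub_comm, mul_pow] at h5
    rw [← Complex.ofReal_sub, Complex.norm_real, Real.norm_eq_abs]
    exact h5.trans (mul_le_mul_of_nonneg_left (sqrt_integral_sq_pow_three_le hf h3) (by positivity))
  calc _ ≤ _ := norm_sub_le_norm_sub_add_norm_sub _ ((1 - u ^ 2 * v / 2 : ℝ) : ℂ) _
    _ ≤ _ := add_le_add hA hB
    _ = _ := by ring

/-- Lyapunov's central limit theorem in quantitative form: the characteristic function of a sum of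
independent centred variables is close to the Gaussian one, with an error controlled by the sum of
the third absolute moments. -/
theorem ProbabilityTheory.iIndepFun.norm_integral_cexp_sum_sub_exp_le {ι : Type*} [Fintype ι]
    {f : ι → Ω → ℝ} (hind : iIndepFun f P) (hf : ∀ i, AEMeasurable (f i) P)
    (h3 : ∀ i, Integrable (fun ω => |f i ω| ^ 3) P) (h0 : ∀ i, ∫ ω, f i ω ∂P = 0) (u : ℝ) :
    ‖∫ ω, Complex.exp ((u * ∑ i, f i ω : ℝ) * Complex.I) ∂P
        - (Real.exp (-(u ^ 2 * (∑ i, ∫ ω, f i ω ^ 2 ∂P) / 2)) : ℂ)‖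
      ≤ 5 * |u| ^ 3 * ∑ i, ∫ ω, |f i ω| ^ 3 ∂P := by
  have e1 : ∫ ω, Complex.exp ((u * ∑ i, f i ω : ℝ) * Complex.I) ∂P
      = ∏ i, ∫ ω, Complex.exp ((u * f i ω : ℝ) * Complex.I) ∂P := by
    rw [← hind.integral_fun_prod_comp (f := fun _ x => Complex.exp ((u * x : ℝ) * Complex.I)) hf
      (fun i => by fun_prop)]
    congr 1; ext ω
    rw [← Complex.exp_sum, Finset.mul_sum]
    push_cast
    rw [Finset.sum_mul]
  have e2 : (Real.exp (-(u ^ 2 * (∑ i, ∫ ω, f i ω ^ 2 ∂P) / 2)) : ℂ)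
      = ∏ i, (Real.exp (-(u ^ 2 * (∫ ω, f i ω ^ 2 ∂P) / 2)) : ℂ) := by
    rw [← Complex.ofReal_prod, ← Real.exp_sum]
    congr 2
    rw [Finset.sum_neg_distrib, Finset.mul_sum, Finset.sum_div]
  rw [e1, e2]
  refine (norm_prod_sub_prod_le_sum _ _ _ (fun i _ => norm_integral_cexp_mul_I_le _)
    fun i _ => ?_).trans ?_
  · rw [Complex.norm_real, Real.norm_eq_abs, abs_of_pos (Real.exp_pos _), Real.exp_le_one_iff]
    have : 0 ≤ ∫ ω, f i ω ^ 2 ∂P := integral_nonneg fun ω => sq_nonneg _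
    have := mul_nonneg (sq_nonneg u) this
    linarith
  · rw [Finset.mul_sum]
    exact Finset.sum_le_sum fun i _ => norm_integral_cexp_sub_exp_le (hf i) (h3 i) (h0 i) u

end CharFun

/-- Grouping a doubly indexed independent family by its first index gives an independent family of
vectors. This is the converse of `iIndepFun_uncurry`. -/
theorem ProbabilityTheory.iIndepFun.curry {ι : Type*} [Countable ι] {κ : ι → Type*}
    [∀ i, Countable (κ i)] {Ω : Type*} [MeasurableSpace Ω] {P : Measure Ω}
    {𝓧 : (i : ι) → κ i → Type*} [∀ i j, MeasurableSpace (𝓧 i j)]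
    {X : (i : ι) → (j : κ i) → Ω → 𝓧 i j} (mX : ∀ i j, AEMeasurable (X i j) P)
    (h : iIndepFun (fun (p : (i : ι) × κ i) ω => X p.1 p.2 ω) P) :
    iIndepFun (fun i ω => (X i · ω)) P := by
  have := h.isProbabilityMeasure
  have hp : ∀ i j, IsProbabilityMeasure (P.map (X i j)) :=
    fun i j => Measure.isProbabilityMeasure_map (mX i j)
  have hrow : ∀ i, iIndepFun (X i) P := fun i =>
    h.precomp (g := fun j => (⟨i, j⟩ : (i : ι) × κ i)) sigma_mk_injective
  have hmrow : ∀ i, AEMeasurable (fun ω => (X i · ω)) P := fun i => aemeasurable_pi_lambda _ (mX i)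
  have e : (MeasurableEquiv.piCurry 𝓧) ∘ (fun ω p ↦ X p.1 p.2 ω) = fun ω i j ↦ X i j ω := by
    ext; simp [Sigma.curry]
  rw [iIndepFun_iff_map_fun_eq_infinitePi_map₀' hmrow, ← e,
    ← AEMeasurable.map_map_of_aemeasurable (by fun_prop)
      (aemeasurable_pi_lambda _ fun p => mX p.1 p.2),
    h.map_fun_eq_infinitePi_map₀' (fun p => mX p.1 p.2)]
  simp_rw [fun i => (hrow i).map_fun_eq_infinitePi_map₀' (mX i)]
  exact Measure.infinitePi_map_piCurry (fun i j => P.map (X i j))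

/-! ### Moments of linear forms in independent variables -/

section LinearForms
variable {Ω : Type*} [MeasurableSpace Ω] {P : Measure Ω} [IsProbabilityMeasure P]

theorem MeasureTheory.MemLp.integrable_abs_pow {f : Ω → ℝ} {k : ℕ} (hf : MemLp f k P) :
    Integrable (fun ω => |f ω| ^ k) P := hf.integrable_norm_pow'

theorem MeasureTheory.MemLp.integrable_pow_of_le {f : Ω → ℝ} {j k : ℕ} (hf : MemLp f k P)
    (hjk : j ≤ k) : Integrable (fun ω => f ω ^ j) P :=
  integrable_pow_of_abs_pow hf.aestronglyMeasurable.aemeasurable hjk hf.integrable_abs_pow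

/-- Binomial expansion of a moment of `f + a g` for independent `f` and `g`; the one-variable
step in the computation of moments of linear forms. -/
theorem ProbabilityTheory.IndepFun.integral_add_const_mul_pow {f g : Ω → ℝ} {k : ℕ}
    (hind : IndepFun f g P) (hf : MemLp f k P) (hg : MemLp g k P) (a : ℝ) :
    ∫ ω, (f ω + a * g ω) ^ k ∂P
      = ∑ j ∈ Finset.range (k + 1),
          (∫ ω, f ω ^ j ∂P) * (a ^ (k - j) * ∫ ω, g ω ^ (k - j) ∂P) * (k.choose j : ℝ) := by
  have hij : ∀ j, IndepFun (fun ω => f ω ^ j) (fun ω => g ω ^ (k - j)) P := fun j =>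
    hind.comp (φ := fun x : ℝ => x ^ j) (ψ := fun x : ℝ => x ^ (k - j)) (by fun_prop) (by fun_prop)
  have hint : ∀ j ∈ Finset.range (k + 1), Integrable (fun ω => f ω ^ j * g ω ^ (k - j)) P :=
    fun j hj => (hij j).integrable_mul
      (hf.integrable_pow_of_le (Nat.lt_succ_iff.1 (Finset.mem_range.1 hj)))
      (hg.integrable_pow_of_le (Nat.sub_le _ _))
  have e : ∀ ω, (f ω + a * g ω) ^ k = ∑ j ∈ Finset.range (k + 1),
      (a ^ (k - j) * (k.choose j : ℝ)) * (f ω ^ j * g ω ^ (k - j)) := fun ω => by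
    rw [add_pow]
    exact Finset.sum_congr rfl fun j _ => by rw [mul_pow]; ring
  simp_rw [e]
  rw [integral_finsetSum _ fun j hj => (hint j hj).const_mul _]
  refine Finset.sum_congr rfl fun j hj => ?_
  rw [integral_const_mul, (hij j).integral_fun_mul_eq_mul_integral
    (hf.aestronglyMeasurable.pow _) (hg.aestronglyMeasurable.pow _)]
  ring

variable {ι : Type*} {S : ι → Ω → ℝ}

omit [IsProbabilityMeasure P] in
theorem memLp_sum_const_mul {p : ENNReal} (hS : ∀ i, MemLp (S i) p P) (x : ι → ℝ) (s : Finset ι) :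
    MemLp (fun ω => ∑ i ∈ s, x i * S i ω) p P :=
  memLp_finsetSum s fun i _ => (hS i).const_mul (x i)

omit [IsProbabilityMeasure P] in
theorem ProbabilityTheory.iIndepFun.indepFun_sum_const_mul (hind : iIndepFun S P)
    (hS : ∀ i, AEMeasurable (S i) P) (x : ι → ℝ) {s : Finset ι} {j : ι} (hj : j ∉ s) :
    IndepFun (fun ω => ∑ i ∈ s, x i * S i ω) (S j) P := by
  classical
  have h := hind.indepFun_finset₀ s {j} (Finset.disjoint_singleton_right.2 hj) hS
  have hψ : Measurable fun y : ({j} : Finset ι) → ℝ => y ⟨j, Finset.mem_singleton_self j⟩ :=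
    measurable_pi_apply _
  have h2 := h.comp (φ := fun y : s → ℝ => ∑ i : s, x i * y i) (by fun_prop) hψ
  convert! h2 using 1
  ext ω
  simp only [Function.comp]
  exact (Finset.sum_coe_sort s fun i => x i * S i ω).symm

theorem ProbabilityTheory.iIndepFun.integral_sum_const_mul_insert_pow (hind : iIndepFun S P) {k : ℕ}
    (hS : ∀ i, MemLp (S i) k P) (x : ι → ℝ) [DecidableEq ι] {s : Finset ι} {j : ι} (hj : j ∉ s) :
    ∫ ω, (∑ i ∈ insert j s, x i * S i ω) ^ k ∂P
      = ∑ l ∈ Finset.range (k + 1), (∫ ω, (∑ i ∈ s, x i * S i ω) ^ l ∂P) *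
          (x j ^ (k - l) * ∫ ω, S j ω ^ (k - l) ∂P) * (k.choose l : ℝ) := by
  rw [← (hind.indepFun_sum_const_mul (fun i => (hS i).aestronglyMeasurable.aemeasurable) x
    hj).integral_add_const_mul_pow (memLp_sum_const_mul hS x s) (hS j)]
  congr 1; ext ω
  rw [Finset.sum_insert hj, add_comm]

omit [IsProbabilityMeasure P] in
theorem integral_sum_const_mul_eq_zero (hS : ∀ i, Integrable (S i) P)
    (h0 : ∀ i, ∫ ω, S i ω ∂P = 0) (x : ι → ℝ) (s : Finset ι) :
    ∫ ω, ∑ i ∈ s, x i * S i ω ∂P = 0 := by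
  rw [integral_finsetSum _ fun i _ => (hS i).const_mul (x i)]
  simp [integral_const_mul, h0]

theorem ProbabilityTheory.iIndepFun.integral_sum_const_mul_sq (hind : iIndepFun S P)
    (hS : ∀ i, MemLp (S i) 2 P) (h0 : ∀ i, ∫ ω, S i ω ∂P = 0) (h1 : ∀ i, ∫ ω, S i ω ^ 2 ∂P = 1)
    (x : ι → ℝ) (s : Finset ι) :
    ∫ ω, (∑ i ∈ s, x i * S i ω) ^ 2 ∂P = ∑ i ∈ s, x i ^ 2 := by
  classical
  induction s using Finset.induction_on with
  | empty => simp
  | insert j s hj ih =>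
    rw [hind.integral_sum_const_mul_insert_pow hS x hj, Finset.sum_insert hj]
    simp [Finset.sum_range_succ, ih, h0, h1]

/-- The excess over the Gaussian value `3 (∑ x i ^ 2) ^ 2` comes from the excess kurtosis of the
entries. -/
theorem ProbabilityTheory.iIndepFun.integral_sum_const_mul_pow_four (hind : iIndepFun S P)
    (hS : ∀ i, MemLp (S i) 4 P) (h0 : ∀ i, ∫ ω, S i ω ∂P = 0) (h1 : ∀ i, ∫ ω, S i ω ^ 2 ∂P = 1)
    (x : ι → ℝ) (s : Finset ι) :
    ∫ ω, (∑ i ∈ s, x i * S i ω) ^ 4 ∂P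
      = 3 * (∑ i ∈ s, x i ^ 2) ^ 2 + ∑ i ∈ s, ((∫ ω, S i ω ^ 4 ∂P) - 3) * x i ^ 4 := by
  classical
  have hS2 : ∀ i, MemLp (S i) 2 P := fun i => (hS i).mono_exponent (by norm_num)
  have hS1 : ∀ i, Integrable (S i) P := fun i => (hS2 i).integrable (by norm_num)
  induction s using Finset.induction_on with
  | empty => simp
  | insert j s hj ih =>
    rw [hind.integral_sum_const_mul_insert_pow hS x hj, Finset.sum_insert hj, Finset.sum_insert hj]
    simp only [Finset.sum_range_succ, Finset.range_zero, Finset.sum_empty, pow_zero, pow_one,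
      integral_sum_const_mul_eq_zero hS1 h0, hind.integral_sum_const_mul_sq hS2 h0 h1, ih, h0, h1,
      Nat.sub_zero, Nat.reduceSub, integral_const, probReal_univ, smul_eq_mul]
    norm_num [Nat.choose]
    ring

theorem ProbabilityTheory.iIndepFun.integral_sum_const_mul_pow_four_le (hind : iIndepFun S P)
    (hS : ∀ i, MemLp (S i) 4 P) (h0 : ∀ i, ∫ ω, S i ω ∂P = 0) (h1 : ∀ i, ∫ ω, S i ω ^ 2 ∂P = 1)
    {K : ℝ} (hK : 1 ≤ K) (h4 : ∀ i, ∫ ω, S i ω ^ 4 ∂P ≤ K) (x : ι → ℝ) (s : Finset ι) :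
    ∫ ω, (∑ i ∈ s, x i * S i ω) ^ 4 ∂P ≤ 3 * K * (∑ i ∈ s, x i ^ 2) ^ 2 := by
  rw [hind.integral_sum_const_mul_pow_four hS h0 h1]
  have e1 : ∑ i ∈ s, ((∫ ω, S i ω ^ 4 ∂P) - 3) * x i ^ 4 ≤ (K - 1) * ∑ i ∈ s, (x i ^ 2) ^ 2 := by
    rw [Finset.mul_sum]
    refine Finset.sum_le_sum fun i _ => ?_
    have : 0 ≤ x i ^ 4 := by positivity
    nlinarith [h4 i]
  have e2 : ∑ i ∈ s, (x i ^ 2) ^ 2 ≤ (∑ i ∈ s, x i ^ 2) ^ 2 :=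
    Finset.sum_sq_le_sq_sum_of_nonneg fun i _ => sq_nonneg _
  nlinarith [sq_nonneg (∑ i ∈ s, x i ^ 2)]

/-- A Khintchine-type inequality. In the inductive step the only mixed moment that neither
vanishes nor is nonnegative is that of order `3 + 3`; it is dominated by those of orders `4 + 2`
and `2 + 4`. -/
theorem ProbabilityTheory.iIndepFun.integral_sum_const_mul_pow_six_le (hind : iIndepFun S P)
    (hS : ∀ i, MemLp (S i) 6 P) (h0 : ∀ i, ∫ ω, S i ω ∂P = 0) (h1 : ∀ i, ∫ ω, S i ω ^ 2 ∂P = 1)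
    {K : ℝ} (hK : 1 ≤ K) (h3 : ∀ i, |∫ ω, S i ω ^ 3 ∂P| ≤ K) (h4 : ∀ i, ∫ ω, S i ω ^ 4 ∂P ≤ K)
    (h6 : ∀ i, ∫ ω, S i ω ^ 6 ∂P ≤ K) (x : ι → ℝ) (s : Finset ι) :
    ∫ ω, (∑ i ∈ s, x i * S i ω) ^ 6 ∂P ≤ 25 * K ^ 2 * (∑ i ∈ s, x i ^ 2) ^ 3 := by
  classical
  have hS4 : ∀ i, MemLp (S i) 4 P := fun i => (hS i).mono_exponent (by norm_num)
  have hS2 : ∀ i, MemLp (S i) 2 P := fun i => (hS i).mono_exponent (by norm_num)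
  have hS1 : ∀ i, Integrable (S i) P := fun i => (hS2 i).integrable (by norm_num)
  induction s using Finset.induction_on with
  | empty => simp
  | insert j s hj ih =>
    have hT := memLp_sum_const_mul hS x s
    have E4 := hind.integral_sum_const_mul_pow_four_le hS4 h0 h1 hK h4 x s
    have E2 := hind.integral_sum_const_mul_sq hS2 h0 h1 x s
    have E3 : 2 * |x j| * |∫ ω, (∑ i ∈ s, x i * S i ω) ^ 3 ∂P|
        ≤ ∫ ω, (∑ i ∈ s, x i * S i ω) ^ 4 ∂P + x j ^ 2 * ∫ ω, (∑ i ∈ s, x i * S i ω) ^ 2 ∂P := by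
      have hT4 := hT.integrable_pow_of_le (j := 4) (k := 6) (by norm_num)
      have hT2 := (hT.integrable_pow_of_le (j := 2) (k := 6) (by norm_num)).const_mul (x j ^ 2)
      have hT3 := (hT.integrable_pow_of_le (j := 3) (k := 6) (by norm_num)).abs.const_mul
        (2 * |x j|)
      rw [← integral_const_mul, ← integral_add hT4 hT2]
      refine (mul_le_mul_of_nonneg_left abs_integral_le_integral_abs (by positivity)).trans ?_
      rw [← integral_const_mul]
      refine integral_mono hT3 (hT4.add hT2) fun ω => ?_
      set T := ∑ i ∈ s, x i * S i ω
      have e : T ^ 4 + x j ^ 2 * T ^ 2 - 2 * |x j| * |T ^ 3| = T ^ 2 * (|T| - |x j|) ^ 2 := by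
        rw [abs_pow, ← sq_abs (x j)]
        have : T ^ 4 = |T| ^ 4 := by rw [← abs_pow, abs_of_nonneg (by positivity)]
        rw [this, ← sq_abs T]; ring
      have : 0 ≤ T ^ 2 * (|T| - |x j|) ^ 2 := by positivity
      linarith
    rw [hind.integral_sum_const_mul_insert_pow hS x hj, Finset.sum_insert hj]
    simp only [Finset.sum_range_succ, Finset.range_zero, Finset.sum_empty, pow_zero, pow_one,
      integral_sum_const_mul_eq_zero hS1 h0, E2, h0, h1,
      Nat.sub_zero, Nat.reduceSub, integral_const, probReal_univ, smul_eq_mul]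
    norm_num [Nat.choose]
    set v := ∑ i ∈ s, x i ^ 2
    set M3 := ∫ ω, (∑ i ∈ s, x i * S i ω) ^ 3 ∂P
    set M4 := ∫ ω, (∑ i ∈ s, x i * S i ω) ^ 4 ∂P
    set M6 := ∫ ω, (∑ i ∈ s, x i * S i ω) ^ 6 ∂P
    set m3 := ∫ ω, S j ω ^ 3 ∂P
    set m4 := ∫ ω, S j ω ^ 4 ∂P
    set m6 := ∫ ω, S j ω ^ 6 ∂P
    set a := x j
    have hv : 0 ≤ v := Finset.sum_nonneg fun i _ => sq_nonneg _
    rw [E2] at E3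
    have b3 : M3 * (a ^ 3 * m3) * 20 ≤ 10 * K * (a ^ 2 * (3 * K * v ^ 2) + a ^ 4 * v) := by
      have c1 : M3 * (a ^ 3 * m3) ≤ a ^ 2 * (|a| * |M3|) * |m3| := by
        refine (le_abs_self _).trans (le_of_eq ?_)
        rw [abs_mul, abs_mul, abs_pow, ← sq_abs a]; ring
      have c2 : a ^ 2 * (|a| * |M3|) * |m3| ≤ a ^ 2 * (|a| * |M3|) * K :=
        mul_le_mul_of_nonneg_left (h3 j) (by positivity)
      have c3 : a ^ 2 * (2 * |a| * |M3|) ≤ a ^ 2 * (3 * K * v ^ 2 + a ^ 2 * v) :=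
        mul_le_mul_of_nonneg_left (by linarith) (by positivity)
      have c4 : K * (a ^ 2 * (2 * |a| * |M3|)) ≤ K * (a ^ 2 * (3 * K * v ^ 2 + a ^ 2 * v)) :=
        mul_le_mul_of_nonneg_left c3 (by linarith)
      nlinarith
    have b4 : a ^ 2 * M4 ≤ a ^ 2 * (3 * K * v ^ 2) := mul_le_mul_of_nonneg_left E4 (by positivity)
    have b2 : v * (a ^ 4 * m4) ≤ v * (a ^ 4 * K) := by
      have := h4 j
      gcongr
    have b6 : a ^ 6 * m6 ≤ a ^ 6 * K := mul_le_mul_of_nonneg_left (h6 j) (by positivity)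
    have hKK : K ≤ K ^ 2 := by nlinarith
    have d1 : 0 ≤ (K ^ 2 - K) * (a ^ 2 * v ^ 2) := mul_nonneg (by linarith) (by positivity)
    have d2 : 0 ≤ (K ^ 2 - K) * (a ^ 4 * v) := mul_nonneg (by linarith) (by positivity)
    have d3 : 0 ≤ (K ^ 2 - K) * a ^ 6 := mul_nonneg (by linarith) (by positivity)
    have d4 : 0 ≤ K ^ 2 * a ^ 6 := by positivity
    have d5 : 0 ≤ K ^ 2 * (a ^ 4 * v) := by positivity
    have d6 : 0 ≤ K ^ 2 * (a ^ 2 * v ^ 2) := by positivity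
    nlinarith

end LinearForms

/-! ### Products of two linear forms -/

section RowProducts
variable {Ω : Type*} [MeasurableSpace Ω] {P : Measure Ω} [IsProbabilityMeasure P]

theorem integrable_abs_mul_pow_three {f g : Ω → ℝ} (hf : MemLp f 6 P) (hg : MemLp g 6 P) :
    Integrable (fun ω => |f ω * g ω| ^ 3) P := by
  have hf6 : Integrable (fun ω => |f ω| ^ 6) P := MemLp.integrable_abs_pow (by exact_mod_cast hf)
  have hg6 : Integrable (fun ω => |g ω| ^ 6) P := MemLp.integrable_abs_pow (by exact_mod_cast hg)
  have hfm := hf.aestronglyMeasurable.aemeasurable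
  have hgm := hg.aestronglyMeasurable.aemeasurable
  refine (hf6.add hg6).mono' (by fun_prop) (Eventually.of_forall fun ω => ?_)
  rw [Real.norm_eq_abs, abs_of_nonneg (by positivity), abs_mul]
  simp only [Pi.add_apply]
  nlinarith [sq_nonneg (|f ω| ^ 3 - |g ω| ^ 3), sq_nonneg (|f ω| ^ 3), sq_nonneg (|g ω| ^ 3)]

/-- Cauchy–Schwarz applied to the cubes of the two factors. -/
theorem integral_abs_mul_pow_three_le {f g : Ω → ℝ} (hf : MemLp f 6 P) (hg : MemLp g 6 P) :
    ∫ ω, |f ω * g ω| ^ 3 ∂P ≤ √(∫ ω, f ω ^ 6 ∂P) * √(∫ ω, g ω ^ 6 ∂P) := by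
  have key : ∀ {h : Ω → ℝ}, MemLp h 6 P → MemLp (fun ω => |h ω| ^ 3) (ENNReal.ofReal 2) P := by
    intro h hh
    have h6 : Integrable (fun ω => |h ω| ^ 6) P := MemLp.integrable_abs_pow (by exact_mod_cast hh)
    have hm := hh.aestronglyMeasurable.aemeasurable
    rw [show ENNReal.ofReal 2 = 2 by norm_num, memLp_two_iff_integrable_sq (by fun_prop)]
    exact h6.congr (Eventually.of_forall fun ω => by ring)
  have H := integral_mul_le_Lp_mul_Lq_of_nonneg (μ := P) Real.HolderConjugate.two_two
    (f := fun ω => |f ω| ^ 3) (g := fun ω => |g ω| ^ 3)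
    (Eventually.of_forall fun ω => by positivity) (Eventually.of_forall fun ω => by positivity)
    (key hf) (key hg)
  have e : ∀ a : ℝ, (|a| ^ 3) ^ (2 : ℝ) = a ^ 6 := fun a => by
    rw [Real.rpow_two, ← pow_mul]
    exact Even.pow_abs ⟨3, rfl⟩ a
  simp only [e, ← Real.sqrt_eq_rpow] at H
  simpa only [abs_mul, mul_pow] using H

variable {ι : Type*} [Fintype ι] {S : ι → Ω → ℝ}

/-- Polarization of `iIndepFun.integral_sum_const_mul_sq`. -/
theorem ProbabilityTheory.iIndepFun.integral_sum_mul_sum (hind : iIndepFun S P)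
    (hS : ∀ i, MemLp (S i) 2 P) (h0 : ∀ i, ∫ ω, S i ω ∂P = 0) (h1 : ∀ i, ∫ ω, S i ω ^ 2 ∂P = 1)
    (x z : ι → ℝ) :
    ∫ ω, (∑ i, x i * S i ω) * (∑ i, z i * S i ω) ∂P = ∑ i, x i * z i := by
  have hint : ∀ y : ι → ℝ, Integrable (fun ω => (∑ i, y i * S i ω) ^ 2) P := fun y =>
    (memLp_sum_const_mul hS y Finset.univ).integrable_sq
  have e : ∀ ω, (∑ i, x i * S i ω) * (∑ i, z i * S i ω)
      = (1 / 4) * (∑ i, (x i + z i) * S i ω) ^ 2 - (1 / 4) * (∑ i, (x i - z i) * S i ω) ^ 2 := by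
    intro ω
    simp only [add_mul, sub_mul, Finset.sum_add_distrib, Finset.sum_sub_distrib]
    ring
  simp_rw [e]
  rw [integral_sub ((hint _).const_mul _) ((hint _).const_mul _), integral_const_mul,
    integral_const_mul, hind.integral_sum_const_mul_sq hS h0 h1 (fun i => x i + z i),
    hind.integral_sum_const_mul_sq hS h0 h1 (fun i => x i - z i), Finset.mul_sum, Finset.mul_sum,
    ← Finset.sum_sub_distrib]
  exact Finset.sum_congr rfl fun i _ => by ring

/-- Polarization of `iIndepFun.integral_sum_const_mul_pow_four`, by
`(u + v) ^ 4 + (u - v) ^ 4 = 2 u ^ 4 + 12 u ^ 2 v ^ 2 + 2 v ^ 4`. -/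
theorem ProbabilityTheory.iIndepFun.integral_sum_mul_sum_sq (hind : iIndepFun S P)
    (hS : ∀ i, MemLp (S i) 4 P) (h0 : ∀ i, ∫ ω, S i ω ∂P = 0) (h1 : ∀ i, ∫ ω, S i ω ^ 2 ∂P = 1)
    (x z : ι → ℝ) :
    ∫ ω, ((∑ i, x i * S i ω) * (∑ i, z i * S i ω)) ^ 2 ∂P
      = (∑ i, x i ^ 2) * (∑ i, z i ^ 2) + 2 * (∑ i, x i * z i) ^ 2
        + ∑ i, ((∫ ω, S i ω ^ 4 ∂P) - 3) * (x i ^ 2 * z i ^ 2) := by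
  have hint : ∀ y : ι → ℝ, Integrable (fun ω => (∑ i, y i * S i ω) ^ 4) P := fun y =>
    MemLp.integrable_pow_of_le (k := 4)
      (by exact_mod_cast memLp_sum_const_mul hS y Finset.univ) le_rfl
  have e : ∀ ω, ((∑ i, x i * S i ω) * (∑ i, z i * S i ω)) ^ 2
      = (1 / 12) * ((∑ i, (x i + z i) * S i ω) ^ 4 + (∑ i, (x i - z i) * S i ω) ^ 4
        - (2 * (∑ i, x i * S i ω) ^ 4 + 2 * (∑ i, z i * S i ω) ^ 4)) := by
    intro ω
    simp only [add_mul, sub_mul, Finset.sum_add_distrib, Finset.sum_sub_distrib]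
    ring
  have hI : Integrable (fun ω => (∑ i, (x i + z i) * S i ω) ^ 4
      + (∑ i, (x i - z i) * S i ω) ^ 4) P := (hint _).add (hint _)
  have hJ : Integrable (fun ω => 2 * (∑ i, x i * S i ω) ^ 4 + 2 * (∑ i, z i * S i ω) ^ 4) P :=
    ((hint x).const_mul 2).add ((hint z).const_mul 2)
  simp_rw [e]
  rw [integral_const_mul, integral_sub hI hJ, integral_add (hint _) (hint _),
    integral_add ((hint _).const_mul _) ((hint _).const_mul _), integral_const_mul,
    integral_const_mul, hind.integral_sum_const_mul_pow_four hS h0 h1 (fun i => x i + z i),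
    hind.integral_sum_const_mul_pow_four hS h0 h1 (fun i => x i - z i),
    hind.integral_sum_const_mul_pow_four hS h0 h1 x,
    hind.integral_sum_const_mul_pow_four hS h0 h1 z]
  have e1 : ∑ i, (x i + z i) ^ 2
      = ∑ i, x i ^ 2 + 2 * ∑ i, x i * z i + ∑ i, z i ^ 2 := by
    rw [Finset.mul_sum, ← Finset.sum_add_distrib, ← Finset.sum_add_distrib]
    exact Finset.sum_congr rfl fun i _ => by ring
  have e2 : ∑ i, (x i - z i) ^ 2
      = ∑ i, x i ^ 2 - 2 * ∑ i, x i * z i + ∑ i, z i ^ 2 := by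
    rw [Finset.mul_sum, ← Finset.sum_sub_distrib, ← Finset.sum_add_distrib]
    exact Finset.sum_congr rfl fun i _ => by ring
  have e3 : ∑ i, ((∫ ω, S i ω ^ 4 ∂P) - 3) * (x i + z i) ^ 4
        + ∑ i, ((∫ ω, S i ω ^ 4 ∂P) - 3) * (x i - z i) ^ 4
      = 2 * ∑ i, ((∫ ω, S i ω ^ 4 ∂P) - 3) * x i ^ 4
        + 2 * ∑ i, ((∫ ω, S i ω ^ 4 ∂P) - 3) * z i ^ 4
        + 12 * ∑ i, ((∫ ω, S i ω ^ 4 ∂P) - 3) * (x i ^ 2 * z i ^ 2) := by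
    simp only [Finset.mul_sum, ← Finset.sum_add_distrib]
    exact Finset.sum_congr rfl fun i _ => by ring
  rw [e1, e2]
  linear_combination (1 / 12) * e3

theorem abs_sum_mul_le_sqrt_mul_sqrt (x z : ι → ℝ) :
    |∑ i, x i * z i| ≤ √(∑ i, x i ^ 2) * √(∑ i, z i ^ 2) := by
  rw [← Real.sqrt_mul (Finset.sum_nonneg fun i _ => sq_nonneg _)]
  exact Real.abs_le_sqrt (Finset.sum_mul_sq_le_sq_mul_sq _ _ _)

/-- The product of two linear forms in the same independent entries has a third absolute central
moment of order `(‖x‖ ‖z‖) ^ 3`. -/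
theorem ProbabilityTheory.iIndepFun.integral_abs_sum_mul_sum_sub_pow_three_le
    (hind : iIndepFun S P)
    (hS : ∀ i, MemLp (S i) 6 P) (h0 : ∀ i, ∫ ω, S i ω ∂P = 0) (h1 : ∀ i, ∫ ω, S i ω ^ 2 ∂P = 1)
    {K : ℝ} (hK : 1 ≤ K) (h3 : ∀ i, |∫ ω, S i ω ^ 3 ∂P| ≤ K) (h4 : ∀ i, ∫ ω, S i ω ^ 4 ∂P ≤ K)
    (h6 : ∀ i, ∫ ω, S i ω ^ 6 ∂P ≤ K) (x z : ι → ℝ) :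
    Integrable (fun ω =>
        |(∑ i, x i * S i ω) * (∑ i, z i * S i ω) - ∑ i, x i * z i| ^ 3) P ∧
      ∫ ω, |(∑ i, x i * S i ω) * (∑ i, z i * S i ω) - ∑ i, x i * z i| ^ 3 ∂P
        ≤ 104 * K ^ 2 * (√(∑ i, x i ^ 2) * √(∑ i, z i ^ 2)) ^ 3 := by
  have hU := memLp_sum_const_mul hS x Finset.univ
  have hV := memLp_sum_const_mul hS z Finset.univ
  have hUm := hU.aestronglyMeasurable.aemeasurable
  have hVm := hV.aestronglyMeasurable.aemeasurable
  set U := fun ω => ∑ i, x i * S i ω with hUdef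
  set V := fun ω => ∑ i, z i * S i ω with hVdef
  set c := ∑ i, x i * z i with hc
  have hUV := integrable_abs_mul_pow_three hU hV
  have hpt : ∀ ω, |U ω * V ω - c| ^ 3 ≤ 4 * |U ω * V ω| ^ 3 + 4 * |c| ^ 3 := fun ω => by
    calc |U ω * V ω - c| ^ 3 ≤ (|U ω * V ω| + |c|) ^ 3 :=
          pow_le_pow_left₀ (abs_nonneg _) (abs_sub _ _) 3
      _ ≤ 2 ^ (3 - 1) * (|U ω * V ω| ^ 3 + |c| ^ 3) :=
          add_pow_le (abs_nonneg _) (abs_nonneg _) 3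
      _ = _ := by norm_num; ring
  have hdom : Integrable (fun ω => 4 * |U ω * V ω| ^ 3 + 4 * |c| ^ 3) P :=
    (hUV.const_mul 4).add (integrable_const _)
  have hint : Integrable (fun ω => |U ω * V ω - c| ^ 3) P := by
    refine hdom.mono' (by fun_prop) (Eventually.of_forall fun ω => ?_)
    rw [Real.norm_eq_abs, abs_of_nonneg (by positivity)]
    exact hpt ω
  refine ⟨hint, (integral_mono hint hdom hpt).trans ?_⟩
  rw [integral_add (hUV.const_mul 4) (integrable_const _), integral_const_mul]
  simp only [integral_const, probReal_univ, smul_eq_mul, one_mul]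
  set A := ∑ i, x i ^ 2
  set B := ∑ i, z i ^ 2
  have hA0 : 0 ≤ A := Finset.sum_nonneg fun i _ => sq_nonneg _
  have hB0 : 0 ≤ B := Finset.sum_nonneg fun i _ => sq_nonneg _
  have hs : ∀ {D : ℝ}, 0 ≤ D → √(25 * K ^ 2 * D ^ 3) = 5 * K * √D ^ 3 := fun {D} hD => by
    rw [show 25 * K ^ 2 * D ^ 3 = (5 * K * √D ^ 3) ^ 2 by
      rw [mul_pow, ← pow_mul, mul_comm 3 2, pow_mul, Real.sq_sqrt hD]; ring]
    exact Real.sqrt_sq (by positivity)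
  have b1 : ∫ ω, |U ω * V ω| ^ 3 ∂P ≤ (5 * K * √A ^ 3) * (5 * K * √B ^ 3) := by
    refine (integral_abs_mul_pow_three_le hU hV).trans ?_
    rw [← hs hA0, ← hs hB0]
    have c1 := Real.sqrt_le_sqrt
      (hind.integral_sum_const_mul_pow_six_le hS h0 h1 hK h3 h4 h6 x Finset.univ)
    have c2 := Real.sqrt_le_sqrt
      (hind.integral_sum_const_mul_pow_six_le hS h0 h1 hK h3 h4 h6 z Finset.univ)
    exact mul_le_mul c1 c2 (Real.sqrt_nonneg _) (Real.sqrt_nonneg _)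
  have b2 : |c| ^ 3 ≤ (√A * √B) ^ 3 :=
    pow_le_pow_left₀ (abs_nonneg _) (abs_sum_mul_le_sqrt_mul_sqrt x z) 3
  have b3 : 0 ≤ (√A * √B) ^ 3 := by positivity
  have hK2 : 1 ≤ K ^ 2 := by nlinarith
  have b4 : (√A * √B) ^ 3 ≤ K ^ 2 * (√A * √B) ^ 3 := le_mul_of_one_le_left b3 hK2
  have b5 : (5 * K * √A ^ 3) * (5 * K * √B ^ 3) = 25 * (K ^ 2 * (√A * √B) ^ 3) := by ring
  linarith

variable {α : Type*} [Fintype α]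

/-- The central limit theorem for `∑ a, (S x)_a (S z)_a` with deterministic `x` and `z`: the rows
of `S` are independent, so this is a sum of independent variables of mean `⟨x, z⟩`. The variance
of a summand, `‖x‖² ‖z‖² + ⟨x, z⟩² + ∑ i, (E S_{a i}⁴ - 3) x i ^ 2 z i ^ 2`, is compared with the
number `N ^ 2`, which it approximates when `x` and `z` are typical and `N` is the dimension. -/
theorem norm_integral_cexp_bilinear_sub_le {S : α → ι → Ω → ℝ}
    (hind : iIndepFun (fun p : α × ι => S p.1 p.2) P)
    (hS : ∀ a i, MemLp (S a i) 6 P) (h0 : ∀ a i, ∫ ω, S a i ω ∂P = 0)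
    (h1 : ∀ a i, ∫ ω, S a i ω ^ 2 ∂P = 1)
    {K : ℝ} (hK : 1 ≤ K) (h3 : ∀ a i, |∫ ω, S a i ω ^ 3 ∂P| ≤ K)
    (h4 : ∀ a i, ∫ ω, S a i ω ^ 4 ∂P ≤ K) (h6 : ∀ a i, ∫ ω, S a i ω ^ 6 ∂P ≤ K)
    (x z : ι → ℝ) (θ N : ℝ) :
    ‖∫ ω, Complex.exp ((θ * ∑ a, (∑ i, x i * S a i ω) * (∑ i, z i * S a i ω) : ℝ) * Complex.I) ∂P
        - Complex.exp ((θ * (Fintype.card α * ∑ i, x i * z i) : ℝ) * Complex.I)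
          * (Real.exp (-(θ ^ 2 * (Fintype.card α * N ^ 2) / 2)) : ℂ)‖
      ≤ Fintype.card α * (520 * K ^ 2 * |θ| ^ 3 * (√(∑ i, x i ^ 2) * √(∑ i, z i ^ 2)) ^ 3
        + θ ^ 2 / 2 * (|(∑ i, x i ^ 2) * (∑ i, z i ^ 2) - N ^ 2| + (∑ i, x i * z i) ^ 2
          + 4 * K * ∑ i, x i ^ 2 * z i ^ 2)) := by
  have hm : ∀ a i, AEMeasurable (S a i) P := fun a i => (hS a i).aestronglyMeasurable.aemeasurable
  have hS4 : ∀ a i, MemLp (S a i) 4 P := fun a i => (hS a i).mono_exponent (by norm_num)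
  have hS2 : ∀ a i, MemLp (S a i) 2 P := fun a i => (hS a i).mono_exponent (by norm_num)
  have hrow : ∀ a, iIndepFun (S a) P := fun a =>
    hind.precomp (g := fun i => (a, i)) (Prod.mk_right_injective a)
  set A := ∑ i, x i ^ 2 with hA
  set B := ∑ i, z i ^ 2 with hB
  set c := ∑ i, x i * z i with hc
  set W : α → Ω → ℝ := fun a ω => (∑ i, x i * S a i ω) * (∑ i, z i * S a i ω) with hW
  have hcurry : iIndepFun (fun a ω => (S a · ω)) P :=
    iIndepFun.curry hm (hind.precomp (g := fun p : (_ : α) × ι => (p.1, p.2))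
      (Equiv.sigmaEquivProd α ι).injective)
  have hindW : iIndepFun (fun a ω => W a ω - c) P :=
    hcurry.comp (fun _ y => (∑ i, x i * y i) * (∑ i, z i * y i) - c) (fun _ => by fun_prop)
  have hWm : ∀ a, AEMeasurable (W a) P := fun a => by fun_prop
  have hW3 := fun a => (hrow a).integral_abs_sum_mul_sum_sub_pow_three_le (hS a) (h0 a) (h1 a) hK
    (h3 a) (h4 a) (h6 a) x z
  have hWI : ∀ a, Integrable (W a) P := fun a =>
    (memLp_sum_const_mul (hS2 a) x Finset.univ).integrable_mul
      (memLp_sum_const_mul (hS2 a) z Finset.univ)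
  have hW1 : ∀ a, ∫ ω, W a ω ∂P = c := fun a =>
    (hrow a).integral_sum_mul_sum (hS2 a) (h0 a) (h1 a) x z
  have hW0 : ∀ a, ∫ ω, (W a ω - c) ∂P = 0 := fun a => by
    rw [integral_sub (hWI a) (integrable_const _), hW1]; simp
  have hWsqI : ∀ a, Integrable (fun ω => (W a ω - c) ^ 2) P := fun a =>
    integrable_pow_of_abs_pow ((hWm a).sub_const c) (show 2 ≤ 3 by norm_num) (hW3 a).1
  have hWsq : ∀ a, ∫ ω, (W a ω - c) ^ 2 ∂P
      = A * B + c ^ 2 + ∑ i, ((∫ ω, S a i ω ^ 4 ∂P) - 3) * (x i ^ 2 * z i ^ 2) := fun a => by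
    have e := (hrow a).integral_sum_mul_sum_sq (hS4 a) (h0 a) (h1 a) x z
    have e2 : ∀ ω, (W a ω) ^ 2 = (W a ω - c) ^ 2 + (2 * c * W a ω - c ^ 2) := fun ω => by ring
    have hI : Integrable (fun ω => 2 * c * W a ω - c ^ 2) P :=
      ((hWI a).const_mul _).sub (integrable_const _)
    change ∫ ω, (W a ω) ^ 2 ∂P = _ at e
    simp_rw [e2] at e
    rw [integral_add (hWsqI a) hI,
      integral_sub ((hWI a).const_mul _) (integrable_const _), integral_const_mul, hW1] at e
    simp only [integral_const, probReal_univ, smul_eq_mul, one_mul] at e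
    linarith
  have hclt := hindW.norm_integral_cexp_sum_sub_exp_le (fun a => (hWm a).sub_const c)
    (fun a => (hW3 a).1) hW0 θ
  set Q := ∑ a, ∫ ω, (W a ω - c) ^ 2 ∂P with hQ
  have hQ0 : 0 ≤ Q := Finset.sum_nonneg fun a _ => integral_nonneg fun ω => sq_nonneg _
  have hQN : |Q - Fintype.card α * N ^ 2| ≤ Fintype.card α * (|A * B - N ^ 2| + c ^ 2
          + 4 * K * ∑ i, x i ^ 2 * z i ^ 2) := by
    have e : Q - Fintype.card α * N ^ 2 = ∑ a, ((∫ ω, (W a ω - c) ^ 2 ∂P) - N ^ 2) := by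
      rw [Finset.sum_sub_distrib, ← hQ]; simp
    rw [e]
    refine (Finset.abs_sum_le_sum_abs _ _).trans ?_
    refine (Finset.sum_le_card_nsmul _ _ (|A * B - N ^ 2| + c ^ 2
      + 4 * K * ∑ i, x i ^ 2 * z i ^ 2) fun a _ => ?_).trans_eq
      (by rw [nsmul_eq_mul, Finset.card_univ])
    rw [hWsq]
    have e3 : |∑ i, ((∫ ω, S a i ω ^ 4 ∂P) - 3) * (x i ^ 2 * z i ^ 2)|
        ≤ 4 * K * ∑ i, x i ^ 2 * z i ^ 2 := by
      rw [Finset.mul_sum]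
      refine (Finset.abs_sum_le_sum_abs _ _).trans (Finset.sum_le_sum fun i _ => ?_)
      rw [abs_mul, abs_of_nonneg (show 0 ≤ x i ^ 2 * z i ^ 2 by positivity)]
      refine mul_le_mul_of_nonneg_right ?_ (by positivity)
      have : 0 ≤ ∫ ω, S a i ω ^ 4 ∂P := integral_nonneg fun ω => by positivity
      rw [abs_le]
      constructor <;> linarith [h4 a i]
    calc _ = |(A * B - N ^ 2) + c ^ 2
            + ∑ i, ((∫ ω, S a i ω ^ 4 ∂P) - 3) * (x i ^ 2 * z i ^ 2)| := by ring_nf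
      _ ≤ |A * B - N ^ 2| + |c ^ 2|
            + |∑ i, ((∫ ω, S a i ω ^ 4 ∂P) - 3) * (x i ^ 2 * z i ^ 2)| := abs_add_three _ _ _
      _ ≤ _ := by rw [abs_of_nonneg (sq_nonneg c)]; linarith
  have hfac : ∀ ω, Complex.exp ((θ * ∑ a, W a ω : ℝ) * Complex.I)
      = Complex.exp ((θ * (Fintype.card α * c) : ℝ) * Complex.I)
        * Complex.exp ((θ * ∑ a, (W a ω - c) : ℝ) * Complex.I) := fun ω => by
    rw [← Complex.exp_add]
    congr 1
    simp only [Finset.sum_sub_distrib, Finset.sum_const, Finset.card_univ, nsmul_eq_mul]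
    push_cast
    ring
  change ‖∫ ω, Complex.exp ((θ * ∑ a, W a ω : ℝ) * Complex.I) ∂P - _‖ ≤ _
  simp_rw [hfac]
  rw [integral_const_mul, ← mul_sub, norm_mul, Complex.norm_exp_ofReal_mul_I, one_mul]
  refine (norm_sub_le_norm_sub_add_norm_sub _ (Real.exp (-(θ ^ 2 * Q / 2)) : ℂ) _).trans ?_
  rw [mul_add]
  refine add_le_add (hclt.trans ?_) ?_
  · have : ∑ a, ∫ ω, |W a ω - c| ^ 3 ∂P ≤ Fintype.card α * (104 * K ^ 2 * (√A * √B) ^ 3) := by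
      refine (Finset.sum_le_card_nsmul _ _ _ fun a _ => (hW3 a).2).trans_eq ?_
      simp [hA, hB]
    calc _ ≤ 5 * |θ| ^ 3 * (Fintype.card α * (104 * K ^ 2 * (√A * √B) ^ 3)) := by gcongr
      _ = _ := by ring
  · rw [← Complex.ofReal_sub, Complex.norm_real, Real.norm_eq_abs]
    refine (abs_exp_neg_sub_exp_neg_le (by positivity) (by positivity)).trans ?_
    rw [← sub_div, ← mul_sub, abs_div, abs_mul, abs_of_nonneg (sq_nonneg θ), abs_two]
    calc _ ≤ θ ^ 2 * (Fintype.card α * (|A * B - N ^ 2| + c ^ 2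
          + 4 * K * ∑ i, x i ^ 2 * z i ^ 2)) / 2 := by gcongr
      _ = _ := by ring

end RowProducts

/-! ### Norms of vectors with independent entries -/

/-- Comparison of the Euclidean and the cubic norm, obtained by summing
`3 r n² y² ≤ 2 n³ y³ + r³` with `r` the Euclidean norm and `n² = card ι`. -/
theorem sqrt_sum_sq_pow_three_le {ι : Type*} [Fintype ι] (x : ι → ℝ) :
    √(∑ i, x i ^ 2) ^ 3 ≤ √(Fintype.card ι) * ∑ i, |x i| ^ 3 := by
  rcases isEmpty_or_nonempty ι with h | h
  · simp
  set r := √(∑ i, x i ^ 2) with hr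
  set n := √(Fintype.card ι : ℝ) with hn
  have hr0 : 0 ≤ r := Real.sqrt_nonneg _
  have hr2 : r ^ 2 = ∑ i, x i ^ 2 := Real.sq_sqrt (Finset.sum_nonneg fun i _ => sq_nonneg _)
  have hn0 : 0 < n := Real.sqrt_pos.2 (by exact_mod_cast Fintype.card_pos)
  have hn2 : n ^ 2 = Fintype.card ι := Real.sq_sqrt (by positivity)
  have hpt : ∀ i, (3 * r * n ^ 2) * x i ^ 2 ≤ (2 * n ^ 3) * |x i| ^ 3 + r ^ 3 := fun i => by
    have h0 := abs_nonneg (x i)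
    rw [← sq_abs (x i)]
    have : 0 ≤ (2 * (n * |x i|) + r) * (n * |x i| - r) ^ 2 := by positivity
    nlinarith
  have hs := Finset.sum_le_sum fun i (_ : i ∈ Finset.univ) => hpt i
  rw [← Finset.mul_sum, Finset.sum_add_distrib, ← Finset.mul_sum, ← hr2] at hs
  simp only [Finset.sum_const, Finset.card_univ, nsmul_eq_mul, ← hn2] at hs
  have : n ^ 2 * (2 * r ^ 3) ≤ n ^ 2 * (2 * (n * ∑ i, |x i| ^ 3)) := by nlinarith
  have := le_of_mul_le_mul_left this (by positivity)
  linarith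

section WLLN
variable {Ω : Type*} [MeasurableSpace Ω] {P : Measure Ω} [IsProbabilityMeasure P]
variable {ι : Type*} [Fintype ι]

theorem sq_sub_min_sq_le {a ρ : ℝ} (hρ : 0 < ρ) : a ^ 2 - min (a ^ 2) (ρ ^ 2) ≤ |a| ^ 3 / ρ := by
  rcases le_total (a ^ 2) (ρ ^ 2) with h | h
  · rw [min_eq_left h, sub_self]; positivity
  · rw [min_eq_right h, le_div_iff₀ hρ, ← sq_abs a]
    have h1 : ρ ≤ |a| := by simpa [abs_of_pos hρ] using sq_le_sq.1 h
    nlinarith [pow_pos hρ 3, sq_nonneg |a|]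

/-- Weak law of large numbers in `L¹` for the squared norm of a vector with independent entries.
With only third moments the squares need not have a variance, so they are truncated at `ρ ^ 2`;
with `ρ ^ 4` equal to the dimension, the truncation error and the standard deviation of the
truncated sum are both of order `ρ ^ 3`. -/
theorem ProbabilityTheory.iIndepFun.integral_abs_sum_sq_sub_card_le {X : ι → Ω → ℝ}
    (hind : iIndepFun X P) (hX : ∀ i, MemLp (X i) 3 P) (h2 : ∀ i, ∫ ω, X i ω ^ 2 ∂P = 1)
    {C : ℝ} (h3 : ∀ i, ∫ ω, |X i ω| ^ 3 ∂P ≤ C) {ρ : ℝ} (hρ : 0 < ρ)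
    (hρN : ρ ^ 4 = Fintype.card ι) :
    ∫ ω, |∑ i, X i ω ^ 2 - Fintype.card ι| ∂P ≤ ρ ^ 3 * (1 + 2 * C) := by
  have hm : ∀ i, AEMeasurable (X i) P := fun i => (hX i).aestronglyMeasurable.aemeasurable
  have hX3 : ∀ i, Integrable (fun ω => |X i ω| ^ 3) P := fun i =>
    MemLp.integrable_abs_pow (by exact_mod_cast hX i)
  have hX2 : ∀ i, Integrable (fun ω => X i ω ^ 2) P := fun i =>
    integrable_pow_of_abs_pow (hm i) (show 2 ≤ 3 by norm_num) (hX3 i)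
  set q : ι → Ω → ℝ := fun i ω => min (X i ω ^ 2) (ρ ^ 2) with hq
  have hqm : ∀ i, AEMeasurable (q i) P := fun i => by fun_prop
  have hq0 : ∀ i ω, 0 ≤ q i ω := fun i ω => le_min (sq_nonneg _) (sq_nonneg _)
  have hqX : ∀ i ω, q i ω ≤ X i ω ^ 2 := fun i ω => min_le_left _ _
  have hqρ : ∀ i ω, q i ω ≤ ρ ^ 2 := fun i ω => min_le_right _ _
  have hqL : ∀ i, MemLp (q i) 2 P := fun i =>
    MemLp.of_bound (hqm i).aestronglyMeasurable (ρ ^ 2) (Eventually.of_forall fun ω => by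
      rw [Real.norm_eq_abs, abs_of_nonneg (hq0 i ω)]; exact hqρ i ω)
  have hqI : ∀ i, Integrable (q i) P := fun i => (hqL i).integrable (by norm_num)
  have hqind : iIndepFun q P :=
    hind.comp (fun _ a => min (a ^ 2) (ρ ^ 2)) (fun _ => by fun_prop)
  set Y : Ω → ℝ := fun ω => ∑ i, q i ω - ∑ i, ∫ ω', q i ω' ∂P with hY
  have hsumL : MemLp (fun ω => ∑ i, q i ω) 2 P := memLp_finsetSum _ fun i _ => hqL i
  have hYL : MemLp Y 2 P := hsumL.sub (memLp_const _)
  have hYsq : ∫ ω, Y ω ^ 2 ∂P ≤ Fintype.card ι * ρ ^ 2 := by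
    have e1 : ∫ ω, Y ω ^ 2 ∂P = Var[∑ i, q i; P] := by
      rw [variance_eq_integral (by fun_prop)]
      simp only [Finset.sum_apply, hY]
      rw [integral_finsetSum _ fun i _ => hqI i]
    rw [e1, IndepFun.variance_sum (fun i _ => hqL i)
      (fun i _ j _ hij => hqind.indepFun hij)]
    refine (Finset.sum_le_card_nsmul _ _ (ρ ^ 2) fun i _ => ?_).trans_eq
      (by rw [nsmul_eq_mul, Finset.card_univ])
    refine (variance_le_expectation_sq (hqm i).aestronglyMeasurable).trans ?_
    calc ∫ ω, (q i ^ 2) ω ∂P ≤ ∫ ω, ρ ^ 2 * X i ω ^ 2 ∂P := by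
          refine integral_mono (hqL i).integrable_sq ((hX2 i).const_mul _) fun ω => ?_
          simp only [Pi.pow_apply]
          nlinarith [hq0 i ω, hqX i ω, hqρ i ω]
      _ = ρ ^ 2 := by rw [integral_const_mul, h2, mul_one]
  have hdiff : ∀ i, ∫ ω, (X i ω ^ 2 - q i ω) ∂P ≤ C / ρ := fun i => by
    calc _ ≤ ∫ ω, |X i ω| ^ 3 / ρ ∂P :=
          integral_mono ((hX2 i).sub (hqI i)) ((hX3 i).div_const ρ) fun ω => sq_sub_min_sq_le hρ
      _ ≤ C / ρ := by
          rw [integral_div]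
          exact div_le_div_of_nonneg_right (h3 i) hρ.le
  have hsumdiff : ∑ i, ∫ ω, (X i ω ^ 2 - q i ω) ∂P ≤ ρ ^ 3 * C := by
    refine (Finset.sum_le_card_nsmul _ _ (C / ρ) fun i _ => hdiff i).trans_eq ?_
    rw [nsmul_eq_mul, Finset.card_univ, ← hρN]
    field_simp
  set δ := ∑ i, ∫ ω, (X i ω ^ 2 - q i ω) ∂P with hδ
  have hδe : (Fintype.card ι : ℝ) - ∑ i, ∫ ω, q i ω ∂P = δ := by
    rw [hδ]
    simp_rw [fun i => integral_sub (hX2 i) (hqI i), h2]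
    simp
  have hpt : ∀ ω, |∑ i, X i ω ^ 2 - Fintype.card ι|
      ≤ (ρ ^ 3 / 2 + Y ω ^ 2 / (2 * ρ ^ 3)) + (∑ i, (X i ω ^ 2 - q i ω) + δ) := fun ω => by
    have e : ∑ i, X i ω ^ 2 - Fintype.card ι = Y ω + (∑ i, (X i ω ^ 2 - q i ω) - δ) := by
      rw [← hδe, Finset.sum_sub_distrib]; ring
    have h5 : 0 ≤ ∑ i, (X i ω ^ 2 - q i ω) :=
      Finset.sum_nonneg fun i _ => sub_nonneg.2 (hqX i ω)
    have h6 : 0 ≤ δ := Finset.sum_nonneg fun i _ =>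
      integral_nonneg fun ω => sub_nonneg.2 (hqX i ω)
    -- Arithmetic–geometric mean inequality, with weight the expected size `ρ ^ 3` of `Y`.
    have h7 : |Y ω| ≤ ρ ^ 3 / 2 + Y ω ^ 2 / (2 * ρ ^ 3) := by
      have hρ3 : 0 < ρ ^ 3 := by positivity
      rw [← sub_nonneg]
      have : ρ ^ 3 / 2 + Y ω ^ 2 / (2 * ρ ^ 3) - |Y ω| = (ρ ^ 3 - |Y ω|) ^ 2 / (2 * ρ ^ 3) := by
        rw [← sq_abs (Y ω)]; field_simp; ring
      rw [this]; positivity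
    rw [e]
    refine (abs_add_le _ _).trans (add_le_add h7 ?_)
    exact (abs_sub _ _).trans_eq (by rw [abs_of_nonneg h5, abs_of_nonneg h6])
  have hsubI : ∀ i, Integrable (fun ω => X i ω ^ 2 - q i ω) P := fun i => (hX2 i).sub (hqI i)
  have hsumI : Integrable (fun ω => ∑ i, (X i ω ^ 2 - q i ω)) P :=
    integrable_finsetSum _ fun i _ => hsubI i
  have hI1 : Integrable (fun ω => ρ ^ 3 / 2 + Y ω ^ 2 / (2 * ρ ^ 3)) P :=
    (integrable_const _).add (hYL.integrable_sq.div_const _)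
  have hI2 : Integrable (fun ω => ∑ i, (X i ω ^ 2 - q i ω) + δ) P :=
    hsumI.add (integrable_const _)
  have hI0 : Integrable (fun ω => |∑ i, X i ω ^ 2 - (Fintype.card ι : ℝ)|) P :=
    ((integrable_finsetSum _ fun i _ => hX2 i).sub (integrable_const _)).abs
  refine (integral_mono hI0 (hI1.add hI2) hpt).trans ?_
  rw [integral_add' hI1 hI2, integral_add (integrable_const _) (hYL.integrable_sq.div_const _),
    integral_add hsumI (integrable_const _), integral_div (2 * ρ ^ 3),
    integral_finsetSum _ fun i _ => hsubI i, ← hδ]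
  simp only [integral_const, probReal_univ, smul_eq_mul, one_mul]
  have h8 : (∫ ω, Y ω ^ 2 ∂P) / (2 * ρ ^ 3) ≤ ρ ^ 3 / 2 := by
    rw [div_le_iff₀ (by positivity)]
    rw [← hρN] at hYsq
    exact hYsq.trans_eq (by ring)
  linarith

end WLLN

/-! ### Conditioning on one of two independent blocks -/

section Blocks
variable {Ω : Type*} [MeasurableSpace Ω] {P : Measure Ω}

/-- Two disjoint blocks of an independent family are independent, as random vectors. -/
theorem ProbabilityTheory.iIndepFun.indepFun_blocks {κ κ₁ κ₂ : Type*} [Fintype κ₁] [Fintype κ₂]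
    {f : κ → Ω → ℝ} (h : iIndepFun f P) (hf : ∀ k, AEMeasurable (f k) P)
    (g₁ : κ₁ → κ) (g₂ : κ₂ → κ) (hg : ∀ a b, g₁ a ≠ g₂ b) :
    IndepFun (fun ω a => f (g₁ a) ω) (fun ω b => f (g₂ b) ω) P := by
  classical
  have hd : Disjoint (Finset.univ.image g₁) (Finset.univ.image g₂) := by
    rw [Finset.disjoint_left]
    intro k h1 h2
    obtain ⟨a, -, rfl⟩ := Finset.mem_image.1 h1
    obtain ⟨b, -, hb⟩ := Finset.mem_image.1 h2
    exact hg a b hb.symm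
  have h1 : Measurable fun (y : ↥(Finset.image g₁ Finset.univ) → ℝ) (a : κ₁) =>
      y ⟨g₁ a, Finset.mem_image_of_mem g₁ (Finset.mem_univ a)⟩ :=
    measurable_pi_lambda _ fun a => measurable_pi_apply _
  have h2 : Measurable fun (y : ↥(Finset.image g₂ Finset.univ) → ℝ) (b : κ₂) =>
      y ⟨g₂ b, Finset.mem_image_of_mem g₂ (Finset.mem_univ b)⟩ :=
    measurable_pi_lambda _ fun b => measurable_pi_apply _
  exact (h.indepFun_finset₀ _ _ hd hf).comp h1 h2

/-- Fubini's theorem for two independent variables on the same probability space: freezing the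
first one at `ω` and integrating over the second plays the role of conditioning on the first. -/
theorem ProbabilityTheory.IndepFun.integral_eq_integral_integral [IsProbabilityMeasure P]
    {E F : Type*} [MeasurableSpace E] [MeasurableSpace F] {f : Ω → E} {g : Ω → F}
    (h : IndepFun f g P) (hf : AEMeasurable f P) (hg : AEMeasurable g P)
    {Φ : E × F → ℂ} (hΦ : Measurable Φ) {M : ℝ} (hM : ∀ p, ‖Φ p‖ ≤ M) :
    Integrable (fun ω => ∫ ω', Φ (f ω, g ω') ∂P) P ∧
      ∫ ω, Φ (f ω, g ω) ∂P = ∫ ω, ∫ ω', Φ (f ω, g ω') ∂P ∂P := by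
  have hPf := Measure.isProbabilityMeasure_map hf
  have hPg := Measure.isProbabilityMeasure_map hg
  have hint : Integrable Φ ((P.map f).prod (P.map g)) :=
    (integrable_const M).mono' hΦ.aestronglyMeasurable (Eventually.of_forall hM)
  have e : ∀ x, ∫ y, Φ (x, y) ∂(P.map g) = ∫ ω', Φ (x, g ω') ∂P := fun x =>
    integral_map hg (hΦ.comp measurable_prodMk_left).aestronglyMeasurable
  have hI := hint.integral_prod_left
  simp_rw [e] at hI
  refine ⟨hI.comp_aemeasurable hf, ?_⟩
  rw [← integral_map (φ := fun ω => (f ω, g ω)) (hf.prodMk hg) hΦ.aestronglyMeasurable,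
    h.map_prod_eq_prod_map_map hf hg, integral_prod _ hint]
  simp_rw [e]
  exact integral_map hf hI.aestronglyMeasurable

end Blocks

/-! ### The bilinear form with random vectors -/

section Main
variable {Ω : Type*} [MeasurableSpace Ω] {P : Measure Ω} [IsProbabilityMeasure P]
variable {ι α : Type*} [Fintype ι] [Fintype α]

omit [IsProbabilityMeasure P] in
theorem ProbabilityTheory.iIndepFun.mul_of_sumElim {κ : Type*} {X Z : ι → Ω → ℝ} {T : κ → Ω → ℝ}
    (hX : ∀ i, AEMeasurable (X i) P) (hZ : ∀ i, AEMeasurable (Z i) P)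
    (h : iIndepFun (Sum.elim X (Sum.elim Z T)) P) :
    iIndepFun (fun i ω => X i ω * Z i ω) P := by
  let g : (_ : ι) × Bool → ι ⊕ (ι ⊕ κ) := fun p =>
    bif p.2 then Sum.inl p.1 else Sum.inr (Sum.inl p.1)
  have hg : Function.Injective g := by
    rintro ⟨i, b⟩ ⟨j, c⟩ hij
    cases b <;> cases c <;> simp_all [g]
  have h1 := h.precomp hg
  have h2 : iIndepFun (fun i ω (b : Bool) => Sum.elim X (Sum.elim Z T) (g ⟨i, b⟩) ω) P :=
    iIndepFun.curry (X := fun i b => Sum.elim X (Sum.elim Z T) (g ⟨i, b⟩))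
      (fun i b => by cases b <;> simp [g, hX, hZ]) h1
  exact h2.comp (fun _ y => y true * y false) (fun _ => by fun_prop)

/-- Quantitative form of the limit theorem. Conditionally on `X` and `Z` the bilinear form is
approximately Gaussian with mean `card α * ⟨X, Z⟩` and variance `card α * (card ι) ^ 2`; the inner
product `⟨X, Z⟩` is itself approximately Gaussian with variance `card ι`, and the two variances add
up. -/
theorem norm_integral_cexp_bilinear_sub_exp_le {X Z : ι → Ω → ℝ} {S : α → ι → Ω → ℝ}
    (hind : iIndepFun (Sum.elim X (Sum.elim Z fun q : α × ι => S q.1 q.2)) P)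
    (hX : ∀ i, MemLp (X i) 3 P) (hZ : ∀ i, MemLp (Z i) 3 P) (hS : ∀ a i, MemLp (S a i) 6 P)
    (hX0 : ∀ i, ∫ ω, X i ω ∂P = 0) (hS0 : ∀ a i, ∫ ω, S a i ω ∂P = 0)
    (hX2 : ∀ i, ∫ ω, X i ω ^ 2 ∂P = 1) (hZ2 : ∀ i, ∫ ω, Z i ω ^ 2 ∂P = 1)
    (hS2 : ∀ a i, ∫ ω, S a i ω ^ 2 ∂P = 1)
    {C : ℝ} (hC : 0 ≤ C) (hX3 : ∀ i, ∫ ω, |X i ω| ^ 3 ∂P ≤ C) (hZ3 : ∀ i, ∫ ω, |Z i ω| ^ 3 ∂P ≤ C)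
    {K : ℝ} (hK : 1 ≤ K) (hS3 : ∀ a i, |∫ ω, S a i ω ^ 3 ∂P| ≤ K)
    (hS4 : ∀ a i, ∫ ω, S a i ω ^ 4 ∂P ≤ K) (hS6 : ∀ a i, ∫ ω, S a i ω ^ 6 ∂P ≤ K)
    {ρ : ℝ} (hρ : 0 < ρ) (hρN : ρ ^ 4 = Fintype.card ι) (θ : ℝ) :
    ‖∫ ω, Complex.exp ((θ * ∑ a, (∑ i, X i ω * S a i ω) * (∑ i, Z i ω * S a i ω) : ℝ)
          * Complex.I) ∂P
        - (Real.exp (-(θ ^ 2 * ((Fintype.card α : ℝ) ^ 2 * Fintype.card ι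
          + Fintype.card α * (Fintype.card ι : ℝ) ^ 2) / 2)) : ℂ)‖
      ≤ Fintype.card α * (520 * K ^ 2 * |θ| ^ 3 * (Fintype.card ι : ℝ) ^ 3 * C ^ 2
          + θ ^ 2 / 2 * (2 * Fintype.card ι * (ρ ^ 3 * (1 + 2 * C)) + Fintype.card ι
            + 4 * K * Fintype.card ι))
        + 5 * |θ * Fintype.card α| ^ 3 * (Fintype.card ι * C ^ 2) := by
  set N : ℝ := (Fintype.card ι : ℝ) with hN
  set m : ℝ := (Fintype.card α : ℝ) with hmdef
  have hXm : ∀ i, AEMeasurable (X i) P := fun i => (hX i).aestronglyMeasurable.aemeasurable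
  have hZm : ∀ i, AEMeasurable (Z i) P := fun i => (hZ i).aestronglyMeasurable.aemeasurable
  have hSm : ∀ a i, AEMeasurable (S a i) P := fun a i => (hS a i).aestronglyMeasurable.aemeasurable
  have hXI3 : ∀ i, Integrable (fun ω => |X i ω| ^ 3) P := fun i =>
    MemLp.integrable_abs_pow (by exact_mod_cast hX i)
  have hZI3 : ∀ i, Integrable (fun ω => |Z i ω| ^ 3) P := fun i =>
    MemLp.integrable_abs_pow (by exact_mod_cast hZ i)
  have hXI2 : ∀ i, Integrable (fun ω => X i ω ^ 2) P := fun i =>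
    integrable_pow_of_abs_pow (hXm i) (show 2 ≤ 3 by norm_num) (hXI3 i)
  have hZI2 : ∀ i, Integrable (fun ω => Z i ω ^ 2) P := fun i =>
    integrable_pow_of_abs_pow (hZm i) (show 2 ≤ 3 by norm_num) (hZI3 i)
  have hall : ∀ k, AEMeasurable (Sum.elim X (Sum.elim Z fun q : α × ι => S q.1 q.2) k) P := by
    rintro (i | i | q)
    exacts [hXm i, hZm i, hSm _ _]
  have iX := hind.precomp (g := (Sum.inl : ι → ι ⊕ (ι ⊕ α × ι))) Sum.inl_injective
  have iZ := hind.precomp (g := fun i : ι => (Sum.inr (Sum.inl i) : ι ⊕ (ι ⊕ α × ι)))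
    (Sum.inr_injective.comp Sum.inl_injective)
  have iS := hind.precomp (g := fun q : α × ι => (Sum.inr (Sum.inr q) : ι ⊕ (ι ⊕ α × ι)))
    (Sum.inr_injective.comp Sum.inr_injective)
  change iIndepFun X P at iX
  change iIndepFun Z P at iZ
  change iIndepFun (fun p : α × ι => S p.1 p.2) P at iS
  have iXZ : IndepFun (fun ω i => X i ω) (fun ω i => Z i ω) P :=
    hind.indepFun_blocks hall Sum.inl (fun i => Sum.inr (Sum.inl i)) (by simp)
  have iXZi : ∀ i, IndepFun (X i) (Z i) P := fun i =>
    iXZ.comp (φ := fun y : ι → ℝ => y i) (ψ := fun y : ι → ℝ => y i) (by fun_prop) (by fun_prop)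
  have iprod : iIndepFun (fun i ω => X i ω * Z i ω) P := hind.mul_of_sumElim hXm hZm
  have iXZS : IndepFun (fun ω => ((fun i => X i ω, fun i => Z i ω) : (ι → ℝ) × (ι → ℝ)))
      (fun ω (q : α × ι) => S q.1 q.2 ω) P := by
    have := hind.indepFun_blocks hall (Sum.elim Sum.inl fun i => Sum.inr (Sum.inl i) : ι ⊕ ι → _)
      (fun q : α × ι => Sum.inr (Sum.inr q)) (by rintro (i | i) q <;> simp)
    exact this.comp (φ := fun y : ι ⊕ ι → ℝ => (fun i => y (Sum.inl i), fun i => y (Sum.inr i)))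
      (ψ := fun y => y) (by fun_prop) measurable_id
  have pI3 : ∀ i, Integrable (fun ω => |X i ω| ^ 3 * |Z i ω| ^ 3) P := fun i =>
    ((iXZi i).comp (φ := fun a => |a| ^ 3) (ψ := fun a => |a| ^ 3) (by fun_prop)
      (by fun_prop)).integrable_mul (hXI3 i) (hZI3 i)
  have pI2 : ∀ i, Integrable (fun ω => X i ω ^ 2 * Z i ω ^ 2) P := fun i =>
    ((iXZi i).comp (φ := fun a => a ^ 2) (ψ := fun a => a ^ 2) (by fun_prop)
      (by fun_prop)).integrable_mul (hXI2 i) (hZI2 i)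
  have p3 : ∀ i, ∫ ω, |X i ω * Z i ω| ^ 3 ∂P ≤ C ^ 2 := fun i => by
    simp_rw [abs_mul, mul_pow]
    have e := ((iXZi i).comp (φ := fun a => |a| ^ 3) (ψ := fun a => |a| ^ 3) (by fun_prop)
      (by fun_prop)).integral_fun_mul_eq_mul_integral (hXI3 i).aestronglyMeasurable
      (hZI3 i).aestronglyMeasurable
    refine e.trans_le ?_
    rw [sq]
    exact mul_le_mul (hX3 i) (hZ3 i) (integral_nonneg fun ω => pow_nonneg (abs_nonneg (Z i ω)) 3) hC
  have p2 : ∀ i, ∫ ω, X i ω ^ 2 * Z i ω ^ 2 ∂P = 1 := fun i => by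
    have e := ((iXZi i).comp (φ := fun a => a ^ 2) (ψ := fun a => a ^ 2) (by fun_prop)
      (by fun_prop)).integral_fun_mul_eq_mul_integral (hXI2 i).aestronglyMeasurable
      (hZI2 i).aestronglyMeasurable
    refine e.trans ?_
    change (∫ ω, X i ω ^ 2 ∂P) * (∫ ω, Z i ω ^ 2 ∂P) = 1
    rw [hX2, hZ2, one_mul]
  have p1 : ∀ i, ∫ ω, X i ω * Z i ω ∂P = 0 := fun i => by
    rw [(iXZi i).integral_fun_mul_eq_mul_integral (hXm i).aestronglyMeasurable
      (hZm i).aestronglyMeasurable, hX0, zero_mul]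
  have pL2 : ∀ i, MemLp (fun ω => X i ω * Z i ω) 2 P := fun i => by
    rw [memLp_two_iff_integrable_sq (by fun_prop)]
    exact (pI2 i).congr (Eventually.of_forall fun ω => by ring)
  -- `c = ⟨X, Z⟩` is a sum of independent centred variables, so it obeys its own limit theorem.
  set c : Ω → ℝ := fun ω => ∑ i, X i ω * Z i ω with hc
  have hcm : AEMeasurable c P := by fun_prop
  have hcL2 : MemLp c 2 P := memLp_finsetSum _ fun i _ => pL2 i
  have hc2 : ∫ ω, c ω ^ 2 ∂P = N := by
    have := iprod.integral_sum_const_mul_sq pL2 p1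
      (fun i => by simp_rw [mul_pow]; exact p2 i) (fun _ => 1) Finset.univ
    simpa using this
  have hcclt : ‖∫ ω, Complex.exp ((θ * (m * c ω) : ℝ) * Complex.I) ∂P
      - (Real.exp (-(θ ^ 2 * (m ^ 2 * N) / 2)) : ℂ)‖ ≤ 5 * |θ * m| ^ 3 * (N * C ^ 2) := by
    have h1 := iprod.norm_integral_cexp_sum_sub_exp_le (fun i => by fun_prop)
      (fun i => (pI3 i).congr (Eventually.of_forall fun ω => by simp [abs_mul, mul_pow])) p1 (θ * m)
    have e1 : ∑ i, ∫ ω, (X i ω * Z i ω) ^ 2 ∂P = N := by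
      simp_rw [mul_pow, p2]; simp [hN]
    have e2 : ∑ i, ∫ ω, |X i ω * Z i ω| ^ 3 ∂P ≤ N * C ^ 2 :=
      (Finset.sum_le_card_nsmul _ _ (C ^ 2) fun i _ => p3 i).trans_eq
        (by rw [nsmul_eq_mul, Finset.card_univ])
    rw [e1] at h1
    refine Eq.trans_le ?_ (h1.trans (mul_le_mul_of_nonneg_left e2 (by positivity)))
    congr 2
    · simp_rw [hc, mul_assoc]
    · congr 2; ring
  -- Integrate first over `S`, with `X` and `Z` frozen.
  let Φ : ((ι → ℝ) × (ι → ℝ)) × (α × ι → ℝ) → ℂ := fun p =>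
    Complex.exp ((θ * ∑ a, (∑ i, p.1.1 i * p.2 (a, i)) * (∑ i, p.1.2 i * p.2 (a, i)) : ℝ)
      * Complex.I)
  obtain ⟨hFI, hF⟩ := iXZS.integral_eq_integral_integral (Φ := Φ) (M := 1) (by fun_prop)
    (by fun_prop) (by fun_prop) (fun p => (Complex.norm_exp_ofReal_mul_I _).le)
  set A : Ω → ℝ := fun ω => ∑ i, X i ω ^ 2 with hA
  set B : Ω → ℝ := fun ω => ∑ i, Z i ω ^ 2 with hB
  set TX : Ω → ℝ := fun ω => ∑ i, |X i ω| ^ 3 with hTX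
  set TZ : Ω → ℝ := fun ω => ∑ i, |Z i ω| ^ 3 with hTZ
  have hAI : Integrable A P := integrable_finsetSum _ fun i _ => hXI2 i
  have hBI : Integrable B P := integrable_finsetSum _ fun i _ => hZI2 i
  have hANI : Integrable (fun ω => |A ω - N|) P := (hAI.sub (integrable_const _)).abs
  have hBNI : Integrable (fun ω => |B ω - N|) P := (hBI.sub (integrable_const _)).abs
  have hTXI : Integrable TX P := integrable_finsetSum _ fun i _ => hXI3 i
  have hTZI : Integrable TZ P := integrable_finsetSum _ fun i _ => hZI3 i
  have hB1 : ∫ ω, B ω ∂P = N := by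
    rw [hB, integral_finsetSum _ fun i _ => hZI2 i]; simp [hZ2, hN]
  have hTX1 : ∫ ω, TX ω ∂P ≤ N * C := by
    rw [hTX, integral_finsetSum _ fun i _ => hXI3 i]
    exact (Finset.sum_le_card_nsmul _ _ C fun i _ => hX3 i).trans_eq
        (by rw [nsmul_eq_mul, Finset.card_univ])
  have hTZ1 : ∫ ω, TZ ω ∂P ≤ N * C := by
    rw [hTZ, integral_finsetSum _ fun i _ => hZI3 i]
    exact (Finset.sum_le_card_nsmul _ _ C fun i _ => hZ3 i).trans_eq
        (by rw [nsmul_eq_mul, Finset.card_univ])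
  have hAN1 := iX.integral_abs_sum_sq_sub_card_le hX hX2 hX3 hρ hρN
  have hBN1 := iZ.integral_abs_sum_sq_sub_card_le hZ hZ2 hZ3 hρ hρN
  have iT : IndepFun TX TZ P := iXZ.comp (φ := fun y : ι → ℝ => ∑ i, |y i| ^ 3)
    (ψ := fun y : ι → ℝ => ∑ i, |y i| ^ 3) (by fun_prop) (by fun_prop)
  have iAB : IndepFun (fun ω => |A ω - N|) B P :=
    iXZ.comp (φ := fun y : ι → ℝ => |∑ i, y i ^ 2 - N|)
    (ψ := fun y : ι → ℝ => ∑ i, y i ^ 2) (by fun_prop) (by fun_prop)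
  have d1I : Integrable (fun ω => TX ω * TZ ω) P := iT.integrable_mul hTXI hTZI
  have d2I : Integrable (fun ω => |A ω - N| * B ω) P := iAB.integrable_mul hANI hBI
  have d3I : Integrable (fun ω => N * |B ω - N|) P := hBNI.const_mul _
  have d4I : Integrable (fun ω => c ω ^ 2) P := hcL2.integrable_sq
  have d5I : Integrable (fun ω => ∑ i, X i ω ^ 2 * Z i ω ^ 2) P :=
    integrable_finsetSum _ fun i _ => pI2 i
  have d1 : ∫ ω, TX ω * TZ ω ∂P ≤ (N * C) * (N * C) := by
    rw [iT.integral_fun_mul_eq_mul_integral hTXI.1 hTZI.1]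
    exact mul_le_mul hTX1 hTZ1 (integral_nonneg fun ω => Finset.sum_nonneg fun i _ => by positivity)
      (by positivity)
  have d2 : ∫ ω, |A ω - N| * B ω ∂P ≤ (ρ ^ 3 * (1 + 2 * C)) * N := by
    rw [iAB.integral_fun_mul_eq_mul_integral hANI.1 hBI.1, hB1]
    exact mul_le_mul_of_nonneg_right hAN1 (by positivity)
  have d3 : ∫ ω, N * |B ω - N| ∂P ≤ N * (ρ ^ 3 * (1 + 2 * C)) := by
    rw [integral_const_mul]
    exact mul_le_mul_of_nonneg_left hBN1 (by positivity)
  have d5 : ∫ ω, ∑ i, X i ω ^ 2 * Z i ω ^ 2 ∂P = N := by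
    rw [integral_finsetSum _ fun i _ => pI2 i]; simp [p2, hN]
  set γ : ℝ := Real.exp (-(θ ^ 2 * (m * N ^ 2) / 2)) with hγ
  have hγ1 : γ ≤ 1 := Real.exp_le_one_iff.2 (by
    have : 0 ≤ θ ^ 2 * (m * N ^ 2) / 2 := by positivity
    linarith)
  -- `D` dominates the error of the conditional limit theorem and is built from products of
  -- independent factors, so that only third moments of the entries of `X` and `Z` enter its mean.
  let D : Ω → ℝ := fun ω => m * (520 * K ^ 2 * |θ| ^ 3 * N * (TX ω * TZ ω)
    + θ ^ 2 / 2 * ((|A ω - N| * B ω + N * |B ω - N|) + c ω ^ 2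
      + 4 * K * ∑ i, X i ω ^ 2 * Z i ω ^ 2))
  have hD23 : Integrable (fun ω => |A ω - N| * B ω + N * |B ω - N|) P := d2I.add d3I
  have hD234 : Integrable (fun ω => (|A ω - N| * B ω + N * |B ω - N|) + c ω ^ 2) P := hD23.add d4I
  have hD2345 : Integrable (fun ω => (|A ω - N| * B ω + N * |B ω - N|) + c ω ^ 2
      + 4 * K * ∑ i, X i ω ^ 2 * Z i ω ^ 2) P := hD234.add (d5I.const_mul _)
  have hDI : Integrable D P :=
    ((d1I.const_mul _).add (hD2345.const_mul _)).const_mul _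
  have hD : ∫ ω, D ω ∂P ≤ m * (520 * K ^ 2 * |θ| ^ 3 * N ^ 3 * C ^ 2
      + θ ^ 2 / 2 * (2 * N * (ρ ^ 3 * (1 + 2 * C)) + N + 4 * K * N)) := by
    have e : ∫ ω, D ω ∂P = m * (520 * K ^ 2 * |θ| ^ 3 * N * (∫ ω, TX ω * TZ ω ∂P)
        + θ ^ 2 / 2 * ((∫ ω, |A ω - N| * B ω ∂P + ∫ ω, N * |B ω - N| ∂P) + N + 4 * K * N)) := by
      simp only [D]
      rw [integral_const_mul, integral_add (d1I.const_mul _) (hD2345.const_mul _),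
        integral_const_mul, integral_const_mul, integral_add hD234 (d5I.const_mul _),
        integral_add hD23 d4I, integral_add d2I d3I, integral_const_mul (4 * K), d5, hc2]
    rw [e]
    have : 520 * K ^ 2 * |θ| ^ 3 * N * (∫ ω, TX ω * TZ ω ∂P)
        ≤ 520 * K ^ 2 * |θ| ^ 3 * N * ((N * C) * (N * C)) := by gcongr
    have h2 : (∫ ω, |A ω - N| * B ω ∂P + ∫ ω, N * |B ω - N| ∂P) + N + 4 * K * N
        ≤ 2 * N * (ρ ^ 3 * (1 + 2 * C)) + N + 4 * K * N := by linarith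
    refine mul_le_mul_of_nonneg_left (add_le_add (this.trans_eq (by ring)) ?_) (by positivity)
    exact mul_le_mul_of_nonneg_left h2 (by positivity)
  have hpt : ∀ ω, ‖∫ ω', Φ ((fun i => X i ω, fun i => Z i ω), fun q => S q.1 q.2 ω') ∂P
      - Complex.exp ((θ * (m * c ω) : ℝ) * Complex.I) * (γ : ℂ)‖ ≤ D ω := fun ω => by
    refine (norm_integral_cexp_bilinear_sub_le iS hS hS0 hS2 hK hS3 hS4 hS6 (fun i => X i ω)
      (fun i => Z i ω) θ N).trans ?_
    have b1 : (√(A ω) * √(B ω)) ^ 3 ≤ N * (TX ω * TZ ω) := by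
      have hNs : √N * √N = N := Real.mul_self_sqrt (by positivity)
      have hTX0 : 0 ≤ TX ω := Finset.sum_nonneg fun i _ => by positivity
      calc (√(A ω) * √(B ω)) ^ 3 = √(A ω) ^ 3 * √(B ω) ^ 3 := mul_pow _ _ _
        _ ≤ (√N * TX ω) * (√N * TZ ω) :=
          mul_le_mul (sqrt_sum_sq_pow_three_le _) (sqrt_sum_sq_pow_three_le _) (by positivity)
            (by positivity)
        _ = (√N * √N) * (TX ω * TZ ω) := by ring
        _ = _ := by rw [hNs]
    have b2 : |A ω * B ω - N ^ 2| ≤ |A ω - N| * B ω + N * |B ω - N| := by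
      have hB0 : 0 ≤ B ω := Finset.sum_nonneg fun i _ => sq_nonneg _
      have hN0 : 0 ≤ N := by positivity
      calc |A ω * B ω - N ^ 2| = |(A ω - N) * B ω + N * (B ω - N)| := by ring_nf
        _ ≤ _ := (abs_add_le _ _).trans_eq (by rw [abs_mul, abs_mul, abs_of_nonneg hB0,
          abs_of_nonneg hN0])
    refine mul_le_mul_of_nonneg_left (add_le_add ?_ ?_) (by positivity)
    · exact (mul_le_mul_of_nonneg_left b1 (by positivity)).trans_eq (by ring)
    · refine mul_le_mul_of_nonneg_left ?_ (by positivity)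
      exact add_le_add_left (add_le_add_left b2 _) _
  have hEI : Integrable (fun ω => Complex.exp ((θ * (m * c ω) : ℝ) * Complex.I) * (γ : ℂ)) P :=
    (integrable_cexp_mul_I ((hcm.const_mul m).const_mul θ)).mul_const _
  have hG : (Real.exp (-(θ ^ 2 * (m ^ 2 * N + m * N ^ 2) / 2)) : ℂ)
      = (Real.exp (-(θ ^ 2 * (m ^ 2 * N) / 2)) : ℂ) * (γ : ℂ) := by
    rw [hγ, ← Complex.ofReal_mul, ← Real.exp_add]
    congr 2; ring
  change ‖∫ ω, Φ ((fun i => X i ω, fun i => Z i ω), fun q => S q.1 q.2 ω) ∂P - _‖ ≤ _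
  rw [hF, hG]
  refine (norm_sub_le_norm_sub_add_norm_sub _
    (∫ ω, Complex.exp ((θ * (m * c ω) : ℝ) * Complex.I) * (γ : ℂ) ∂P) _).trans (add_le_add ?_ ?_)
  · rw [← integral_sub hFI hEI]
    exact (norm_integral_le_of_norm_le hDI (Eventually.of_forall hpt)).trans hD
  · rw [integral_mul_const, ← sub_mul, norm_mul, Complex.norm_real, Real.norm_eq_abs,
      abs_of_pos (Real.exp_pos _)]
    exact (mul_le_of_le_one_right (norm_nonneg _) hγ1).trans hcclt

end Main

/-! ### The limit -/

theorem dotProduct_transpose_mul_self_mulVec {α ι R : Type*} [Fintype α] [Fintype ι]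
    [CommSemiring R] (x z : ι → R) (S : Matrix α ι R) :
    x ⬝ᵥ ((Sᵀ * S) *ᵥ z) = ∑ a, (∑ i, x i * S a i) * (∑ i, z i * S a i) := by
  rw [← Matrix.mulVec_mulVec, Matrix.dotProduct_mulVec, Matrix.vecMul_transpose]
  simp only [dotProduct, Matrix.mulVec]
  exact Finset.sum_congr rfl fun a _ => by
    congr 1 <;> exact Finset.sum_congr rfl fun i _ => mul_comm _ _

section Moments
variable {Ω : Type*} [MeasurableSpace Ω] {P : Measure Ω} [IsProbabilityMeasure P]

theorem integral_abs_pow_le_one_add {f : Ω → ℝ} {j k : ℕ} (hf : MemLp f k P) (hjk : j ≤ k) :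
    ∫ ω, |f ω| ^ j ∂P ≤ 1 + ∫ ω, |f ω| ^ k ∂P := by
  have hm := hf.aestronglyMeasurable.aemeasurable
  have hk := hf.integrable_abs_pow
  have h1 : ∫ ω, (1 + |f ω| ^ k) ∂P = 1 + ∫ ω, |f ω| ^ k ∂P := by
    rw [integral_add (integrable_const _) hk]; simp
  rw [← h1]
  refine integral_mono (integrable_abs_pow_of_le hm hjk hk) ((integrable_const _).add hk)
    fun ω => ?_
  simp only
  rcases le_total |f ω| 1 with h | h
  · exact (pow_le_one₀ (abs_nonneg _) h).trans (by simp)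
  · exact (pow_le_pow_right₀ h hjk).trans (by simp)

end Moments

/-- Here `u ^ 2` and `ρ ^ 4` are the numbers of rows and columns, and `θ = t / s` with `s` the
normalization. The assumption on `θ` says that `|θ| u ρ⁴` and `|θ| u² ρ²` are the legs of a right
triangle with hypotenuse `|t|`; every term of the bound is one of these legs times a quantity that
vanishes in the limit, whatever the ratio of the two dimensions. -/
theorem error_bound_le {u ρ θ t C K : ℝ} (hu : 0 < u) (hρ : 0 < ρ) (hC : 0 ≤ C) (hK : 0 ≤ K)
    (hθ : θ ^ 2 * ((u ^ 2) ^ 2 * ρ ^ 4 + u ^ 2 * (ρ ^ 4) ^ 2) = t ^ 2) :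
    u ^ 2 * (520 * K ^ 2 * |θ| ^ 3 * (ρ ^ 4) ^ 3 * C ^ 2
          + θ ^ 2 / 2 * (2 * ρ ^ 4 * (ρ ^ 3 * (1 + 2 * C)) + ρ ^ 4 + 4 * K * ρ ^ 4))
        + 5 * |θ * u ^ 2| ^ 3 * (ρ ^ 4 * C ^ 2)
      ≤ 520 * K ^ 2 * C ^ 2 * |t| ^ 3 * u⁻¹
        + t ^ 2 / 2 * (2 * (1 + 2 * C) * ρ⁻¹ + (1 + 4 * K) * ρ⁻¹ ^ 4)
        + 5 * C ^ 2 * |t| ^ 3 * ρ⁻¹ ^ 2 := by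
  set a := |θ| * (u * ρ ^ 4) with ha
  set b := |θ| * (u ^ 2 * ρ ^ 2) with hb
  have ha0 : 0 ≤ a := by positivity
  have hb0 : 0 ≤ b := by positivity
  have hab : a ^ 2 + b ^ 2 = t ^ 2 := by
    rw [← hθ, ha, hb]; simp only [mul_pow, sq_abs]; ring
  have hat2 : a ^ 2 ≤ t ^ 2 := by nlinarith [sq_nonneg b]
  have hat : a ≤ |t| := by simpa [abs_of_nonneg ha0] using sq_le_sq.1 hat2
  have hbt : b ≤ |t| := by
    have : b ^ 2 ≤ t ^ 2 := by nlinarith [sq_nonneg a]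
    simpa [abs_of_nonneg hb0] using sq_le_sq.1 this
  have e1 : u ^ 2 * (520 * K ^ 2 * |θ| ^ 3 * (ρ ^ 4) ^ 3 * C ^ 2)
      = 520 * K ^ 2 * C ^ 2 * a ^ 3 * u⁻¹ := by
    rw [ha]; field_simp
  have e2 : u ^ 2 * (θ ^ 2 / 2 * (2 * ρ ^ 4 * (ρ ^ 3 * (1 + 2 * C)) + ρ ^ 4 + 4 * K * ρ ^ 4))
      = a ^ 2 / 2 * (2 * (1 + 2 * C) * ρ⁻¹ + (1 + 4 * K) * ρ⁻¹ ^ 4) := by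
    rw [ha, mul_pow, sq_abs]; field_simp; ring
  have e3 : 5 * |θ * u ^ 2| ^ 3 * (ρ ^ 4 * C ^ 2) = 5 * C ^ 2 * b ^ 3 * ρ⁻¹ ^ 2 := by
    rw [hb, abs_mul, abs_of_pos (by positivity : 0 < u ^ 2)]; field_simp
  rw [mul_add, e1, e2, e3]
  gcongr

theorem mainTheorem3
    {Ω : ℕ → ℕ → Type*} [∀ m n, MeasurableSpace (Ω m n)]
    (P : ∀ m n, Measure (Ω m n)) [∀ m n, IsProbabilityMeasure (P m n)]
    (X : ∀ m n, Ω m n → Fin n → ℝ)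
    (Z : ∀ m n, Ω m n → Fin n → ℝ)
    (S : ∀ m n, Ω m n → Matrix (Fin m) (Fin n) ℝ)
    -- all the entries of `X`, `Z` and `S` are mutually independent
    (hindep : ∀ m n, iIndepFun
      (Sum.elim (fun (i : Fin n) (ω : Ω m n) => X m n ω i)
        (Sum.elim (fun (i : Fin n) (ω : Ω m n) => Z m n ω i)
          (fun (q : Fin m × Fin n) (ω : Ω m n) => S m n ω q.1 q.2))) (P m n))
    -- the entries of each of them are identically distributed
    (hXid : ∀ m n (i j : Fin n),
      IdentDistrib (fun ω => X m n ω i) (fun ω => X m n ω j) (P m n) (P m n))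
    (hZid : ∀ m n (i j : Fin n),
      IdentDistrib (fun ω => Z m n ω i) (fun ω => Z m n ω j) (P m n) (P m n))
    (hSid : ∀ m n (i i' : Fin m) (j j' : Fin n),
      IdentDistrib (fun ω => S m n ω i j) (fun ω => S m n ω i' j') (P m n) (P m n))
    -- finite moments
    (hXmem : ∀ m n (i : Fin n), MemLp (fun ω => X m n ω i) 3 (P m n))
    (hZmem : ∀ m n (i : Fin n), MemLp (fun ω => Z m n ω i) 4 (P m n))
    (hSmem : ∀ m n (i : Fin m) (j : Fin n), MemLp (fun ω => S m n ω i j) 8 (P m n))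
    -- centred, with unit variance
    (hXmean : ∀ m n (i : Fin n), ∫ ω, X m n ω i ∂(P m n) = 0)
    (hZmean : ∀ m n (i : Fin n), ∫ ω, Z m n ω i ∂(P m n) = 0)
    (hSmean : ∀ m n (i : Fin m) (j : Fin n), ∫ ω, S m n ω i j ∂(P m n) = 0)
    (hXvar : ∀ m n (i : Fin n), ∫ ω, X m n ω i ^ 2 ∂(P m n) = 1)
    (hZvar : ∀ m n (i : Fin n), ∫ ω, Z m n ω i ^ 2 ∂(P m n) = 1)
    (hSvar : ∀ m n (i : Fin m) (j : Fin n), ∫ ω, S m n ω i j ^ 2 ∂(P m n) = 1)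
    -- moment bounds, uniform in the dimensions
    (C : ℝ)
    (hX3 : ∀ m n (i : Fin n), ∫ ω, |X m n ω i| ^ 3 ∂(P m n) < C)
    (hZ3 : ∀ m n (i : Fin n), ∫ ω, |Z m n ω i| ^ 3 ∂(P m n) < C)
    (hZ4 : ∀ m n (i : Fin n), ∫ ω, Z m n ω i ^ 4 ∂(P m n) < C)
    (hS8 : ∀ m n (i : Fin m) (j : Fin n), ∫ ω, S m n ω i j ^ 8 ∂(P m n) < C) :
    TendstoInDistribution
      (fun (p : ℕ × ℕ) (ω : Ω p.1 p.2) =>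
        (Real.sqrt ((p.1 : ℝ) ^ 2 * (p.2 : ℝ) + (p.1 : ℝ) * (p.2 : ℝ) ^ 2))⁻¹ *
          (X p.1 p.2 ω ⬝ᵥ (((S p.1 p.2 ω)ᵀ * S p.1 p.2 ω) *ᵥ Z p.1 p.2 ω)))
      (atTop ×ˢ atTop) (id : ℝ → ℝ)
      (fun p : ℕ × ℕ => P p.1 p.2) (gaussianReal 0 1) := by
  have hXm : ∀ m n i, AEMeasurable (fun ω => X m n ω i) (P m n) :=
    fun m n i => (hXmem m n i).aestronglyMeasurable.aemeasurable
  have hZm : ∀ m n i, AEMeasurable (fun ω => Z m n ω i) (P m n) :=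
    fun m n i => (hZmem m n i).aestronglyMeasurable.aemeasurable
  have hSm : ∀ m n i j, AEMeasurable (fun ω => S m n ω i j) (P m n) :=
    fun m n i j => (hSmem m n i j).aestronglyMeasurable.aemeasurable
  have hWm : ∀ p : ℕ × ℕ, AEMeasurable (fun ω : Ω p.1 p.2 =>
      (Real.sqrt ((p.1 : ℝ) ^ 2 * (p.2 : ℝ) + (p.1 : ℝ) * (p.2 : ℝ) ^ 2))⁻¹ *
        (X p.1 p.2 ω ⬝ᵥ (((S p.1 p.2 ω)ᵀ * S p.1 p.2 ω) *ᵥ Z p.1 p.2 ω))) (P p.1 p.2) := by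
    intro p
    simp_rw [dotProduct_transpose_mul_self_mulVec]
    have h1 := hXm p.1 p.2
    have h2 := hZm p.1 p.2
    have h3 := hSm p.1 p.2
    fun_prop
  have hchar : ∀ t : ℝ, Tendsto (fun p : ℕ × ℕ => charFun ((P p.1 p.2).map (fun ω : Ω p.1 p.2 =>
      (Real.sqrt ((p.1 : ℝ) ^ 2 * (p.2 : ℝ) + (p.1 : ℝ) * (p.2 : ℝ) ^ 2))⁻¹ *
        (X p.1 p.2 ω ⬝ᵥ (((S p.1 p.2 ω)ᵀ * S p.1 p.2 ω) *ᵥ Z p.1 p.2 ω)))) t)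
      (atTop ×ˢ atTop) (nhds (Real.exp (-(t ^ 2 / 2)) : ℂ)) := by
    intro t
    have hm : Tendsto (fun p : ℕ × ℕ => (√(p.1 : ℝ))⁻¹) (atTop ×ˢ atTop) (nhds 0) :=
      tendsto_inv_atTop_zero.comp (Real.tendsto_sqrt_atTop.comp
        (tendsto_natCast_atTop_atTop.comp tendsto_fst))
    have hn : Tendsto (fun p : ℕ × ℕ => (√√(p.2 : ℝ))⁻¹) (atTop ×ˢ atTop) (nhds 0) :=
      tendsto_inv_atTop_zero.comp (Real.tendsto_sqrt_atTop.comp (Real.tendsto_sqrt_atTop.comp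
        (tendsto_natCast_atTop_atTop.comp tendsto_snd)))
    have hlim : Tendsto (fun p : ℕ × ℕ =>
        520 * (1 + C) ^ 2 * C ^ 2 * |t| ^ 3 * (√(p.1 : ℝ))⁻¹
        + t ^ 2 / 2 * (2 * (1 + 2 * C) * (√√(p.2 : ℝ))⁻¹
          + (1 + 4 * (1 + C)) * (√√(p.2 : ℝ))⁻¹ ^ 4)
        + 5 * C ^ 2 * |t| ^ 3 * (√√(p.2 : ℝ))⁻¹ ^ 2) (atTop ×ˢ atTop) (nhds 0) := by
      have := ((hm.const_mul (520 * (1 + C) ^ 2 * C ^ 2 * |t| ^ 3)).add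
        (((hn.const_mul (2 * (1 + 2 * C))).add
          ((hn.pow 4).const_mul (1 + 4 * (1 + C)))).const_mul (t ^ 2 / 2))).add
        ((hn.pow 2).const_mul (5 * C ^ 2 * |t| ^ 3))
      simpa using this
    rw [tendsto_iff_norm_sub_tendsto_zero]
    refine squeeze_zero' (Eventually.of_forall fun p => norm_nonneg _) ?_ hlim
    filter_upwards [(eventually_ge_atTop 1).prod_mk (eventually_ge_atTop 1)] with p hp
    obtain ⟨m, n⟩ := p
    obtain ⟨hm1, hn1⟩ : 1 ≤ m ∧ 1 ≤ n := hp
    have hmR : (0 : ℝ) < m := by exact_mod_cast hm1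
    have hnR : (0 : ℝ) < n := by exact_mod_cast hn1
    have hC : 0 ≤ C :=
      (integral_nonneg fun ω => by positivity).trans (hX3 m n ⟨0, hn1⟩).le
    have hS8' : ∀ i j, ∫ ω, |S m n ω i j| ^ 8 ∂(P m n) ≤ C := fun i j => by
      simpa only [Even.pow_abs (show Even 8 by decide)] using (hS8 m n i j).le
    have hSk : ∀ k ≤ 8, ∀ i j, ∫ ω, |S m n ω i j| ^ k ∂(P m n) ≤ 1 + C := fun k hk i j =>
      (integral_abs_pow_le_one_add (by exact_mod_cast hSmem m n i j) hk).trans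
        (by linarith [hS8' i j])
    -- With `m = u ^ 2` and `n = ρ ^ 4`, all powers in the error bound become integral.
    set u := √(m : ℝ) with hu
    set ρ := √√(n : ℝ) with hρ
    have hu0 : 0 < u := Real.sqrt_pos.2 hmR
    have hρ0 : 0 < ρ := Real.sqrt_pos.2 (Real.sqrt_pos.2 hnR)
    have hu2 : u ^ 2 = m := Real.sq_sqrt hmR.le
    have hρ4 : ρ ^ 4 = n := by
      rw [show ρ ^ 4 = (ρ ^ 2) ^ 2 by ring, hρ, Real.sq_sqrt (Real.sqrt_nonneg _),
        Real.sq_sqrt hnR.le]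
    set s := Real.sqrt ((m : ℝ) ^ 2 * (n : ℝ) + (m : ℝ) * (n : ℝ) ^ 2) with hs
    have hs0 : 0 < s := Real.sqrt_pos.2 (by positivity)
    have hs2 : s ^ 2 = (m : ℝ) ^ 2 * (n : ℝ) + (m : ℝ) * (n : ℝ) ^ 2 := Real.sq_sqrt (by positivity)
    have hθ : (t * s⁻¹) ^ 2 * ((m : ℝ) ^ 2 * n + m * (n : ℝ) ^ 2) = t ^ 2 := by
      rw [← hs2]; field_simp
    have key := norm_integral_cexp_bilinear_sub_exp_le (P := P m n)
      (X := fun i ω => X m n ω i) (Z := fun i ω => Z m n ω i) (S := fun a i ω => S m n ω a i)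
      (hindep m n) (hXmem m n) (fun i => (hZmem m n i).mono_exponent (by norm_num))
      (fun a i => (hSmem m n a i).mono_exponent (by norm_num)) (hXmean m n) (hSmean m n)
      (hXvar m n) (hZvar m n) (hSvar m n) hC (fun i => (hX3 m n i).le)
      (fun i => (hZ3 m n i).le) (K := 1 + C) (by linarith)
      (fun a i => abs_integral_le_integral_abs.trans
        (by simpa only [abs_pow] using hSk 3 (by norm_num) a i))
      (fun a i => by
        simpa only [Even.pow_abs (show Even 4 by decide)] using hSk 4 (by norm_num) a i)
      (fun a i => by
        simpa only [Even.pow_abs (show Even 6 by decide)] using hSk 6 (by norm_num) a i)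
      hρ0 (by simpa using hρ4) (t * s⁻¹)
    simp only [Fintype.card_fin] at key
    have hbound := error_bound_le (t := t) (θ := t * s⁻¹) hu0 hρ0 hC (by linarith : 0 ≤ 1 + C)
      (by rw [hu2, hρ4]; exact hθ)
    rw [hu2, hρ4] at hbound
    refine Eq.trans_le ?_ (key.trans hbound)
    rw [charFun_apply_real, integral_map (hWm (m, n)) (by fun_prop), hθ]
    congr 2
    refine integral_congr_ae (Eventually.of_forall fun ω => ?_)
    simp only [dotProduct_transpose_mul_self_mulVec]
    congr 1
    push_cast
    ring
  refine ⟨hWm, by fun_prop, ?_⟩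
  -- Lévy's theorem is available for sequences; the filter is countably generated.
  refine tendsto_of_seq_tendsto fun q hq => ?_
  refine ProbabilityMeasure.tendsto_iff_tendsto_charFun.2 fun t => ?_
  have h := (hchar t).comp hq
  have hg : charFun ((gaussianReal 0 1).map (id : ℝ → ℝ)) t = (Real.exp (-(t ^ 2 / 2)) : ℂ) := by
    rw [Measure.map_id, charFun_gaussianReal]
    push_cast
    congr 1
    simp
  change Tendsto _ atTop (nhds (charFun ((gaussianReal 0 1).map (id : ℝ → ℝ)) t))
  rw [hg]
  exact h
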